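/- Let $M$ be a closed $(2n+1)$-dimensional smooth manifold with a contact form $\alpha$ and the co-oriented contact structure $\xi=\ker\alpha$. Let $\mathrm{Cont}_0(M)$ be the group of contactomorphisms of $(M,\xi)$ that are isotopic to $\mathrm{id}_M$ through contactomorphisms, and for $\phi\in\mathrm{Cont}_0(M)$ put $$|\phi|_\alpha=\inf\Big\{\int_0^1\max_M|\alpha(X_t)|\,dt\Big\},$$ the infimum being over all smooth paths $(\phi_t)_{t\in[0,1]}$ of contactomorphisms with $\phi_0=\mathrm{id}_M$, $\phi_1=\phi$, where $X_t\circ\phi_t=\frac{d}{dt}\phi_t$. Let $L$ be a closed Legendrian submanifold of $M$ and $\mathcal L$ its Legendrian isotopy class. For $L_0,L_1\in\mathcal L$ write $L_0\ll L_1$ (respectively $L_0\preccurlyeq L_1$) if there is a smooth parametrised Legendrian isotopy $l_t$, $t\in[0,1]$, from $L_0$ to $L_1$ with $\alpha(\frac{d}{dt}l_t)>0$ (respectively $\ge 0$) everywhere. Let $I^+(L_0)=\{K\in\mathcal L: L_0\ll K\}$ and $I^-(L_0)=\{K\in\mathcal L: K\ll L_0\}$. The interval topology on $\mathcal L$ is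 the topology generated by the sets $I^+(L_0)\cap I^-(L_1)$ with $L_0,L_1\in\mathcal L$. The Rosen–Zhang metric on $\mathcal L$ is $$d_\alpha(L_0,L_1)=\inf\{|\phi|_\alpha:\phi\in\mathrm{Cont}_0(M),\ \phi(L_0)=L_1\}.$$ Suppose that $\mathcal L$ is orderable, i.e. that $\preccurlyeq$ is a partial order on $\mathcal L$. Then the interval topology on $\mathcal L$ is coarser than (that is, contained in) the topology induced by $d_\alpha$. In particular, for every $L_0\in\mathcal L$ the sets $I^+(L_0)$ and $I^-(L_0)$ are open in the topology induced by $d_\alpha$. -/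

import Mathlib

open scoped Manifold ContDiff Topology
open Set

noncomputable section

namespace Contact

/-- The expression in the chart at `x` of a `1`-form `α` on `M`: a `1`-form on the model space. -/
def localForm {n : ℕ} {M : Type*} [TopologicalSpace M]
    [ChartedSpace (EuclideanSpace ℝ (Fin (2 * n + 1))) M]
    (α : ∀ x : M, TangentSpace (𝓡 (2 * n + 1)) x →L[ℝ] ℝ) (x : M)
    (y : EuclideanSpace ℝ (Fin (2 * n + 1))) :
    EuclideanSpace ℝ (Fin (2 * n + 1)) →L[ℝ] ℝ :=
  (α ((extChartAt (𝓡 (2 * n + 1)) x).symm y)).comp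
    (mfderiv 𝓘(ℝ, EuclideanSpace ℝ (Fin (2 * n + 1))) (𝓡 (2 * n + 1))
      (extChartAt (𝓡 (2 * n + 1)) x).symm y)

/-- The exterior derivative `dα` at `x`, evaluated on two tangent vectors at `x`: the exterior
derivative of the chart expression of `α`, evaluated on the images of the vectors. -/
def exteriorDeriv {n : ℕ} {M : Type*} [TopologicalSpace M]
    [ChartedSpace (EuclideanSpace ℝ (Fin (2 * n + 1))) M]
    (α : ∀ x : M, TangentSpace (𝓡 (2 * n + 1)) x →L[ℝ] ℝ) (x : M)
    (v w : TangentSpace (𝓡 (2 * n + 1)) x) : ℝ :=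
  extDeriv
    (fun y => ContinuousAlternatingMap.ofSubsingleton ℝ (EuclideanSpace ℝ (Fin (2 * n + 1))) ℝ
      (0 : Fin 1) (localForm α x y))
    (extChartAt (𝓡 (2 * n + 1)) x x)
    ![mfderiv (𝓡 (2 * n + 1)) 𝓘(ℝ, EuclideanSpace ℝ (Fin (2 * n + 1)))
        (extChartAt (𝓡 (2 * n + 1)) x) x v,
      mfderiv (𝓡 (2 * n + 1)) 𝓘(ℝ, EuclideanSpace ℝ (Fin (2 * n + 1)))
        (extChartAt (𝓡 (2 * n + 1)) x) x w]

/-- A (smooth) contact form on a `(2n+1)`-dimensional manifold `M` without boundary: a smooth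
section `α` of the cotangent bundle such that, at every point `x`, `α x ≠ 0` and the exterior
derivative `dα` is nondegenerate on the hyperplane `ker (α x)` (equivalently,
`α ∧ (dα)^n` vanishes nowhere).  The form determines the contact
structure `ξ = ker α` together with its co-orientation. -/
structure ContactForm (n : ℕ) (M : Type*) [TopologicalSpace M]
    [ChartedSpace (EuclideanSpace ℝ (Fin (2 * n + 1))) M]
    [IsManifold (𝓡 (2 * n + 1)) ∞ M] where
  form : ∀ x : M, TangentSpace (𝓡 (2 * n + 1)) x →L[ℝ] ℝ
  smooth : ContMDiff (𝓡 (2 * n + 1))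
    ((𝓡 (2 * n + 1)).prod 𝓘(ℝ, EuclideanSpace ℝ (Fin (2 * n + 1)) →L[ℝ] ℝ)) ∞
    (fun x => Bundle.TotalSpace.mk' (EuclideanSpace ℝ (Fin (2 * n + 1)) →L[ℝ] ℝ)
      (E := fun x : M => TangentSpace (𝓡 (2 * n + 1)) x →L[ℝ] Bundle.Trivial M ℝ x) x (form x))
  ne_zero : ∀ x, form x ≠ 0
  nondegenerate : ∀ x (v : TangentSpace (𝓡 (2 * n + 1)) x), form x v = 0 →
    (∀ w : TangentSpace (𝓡 (2 * n + 1)) x, form x w = 0 → exteriorDeriv form x v w = 0) → v = 0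

section

variable {n : ℕ} {M : Type*} [TopologicalSpace M]
  [ChartedSpace (EuclideanSpace ℝ (Fin (2 * n + 1))) M] [IsManifold (𝓡 (2 * n + 1)) ∞ M]

/-- The velocity `d/ds|_{s=t} c s` of a curve `c` in `M`. -/
def velocity (n : ℕ) {M : Type*} [TopologicalSpace M]
    [ChartedSpace (EuclideanSpace ℝ (Fin (2 * n + 1))) M] (c : ℝ → M) (t : ℝ) :
    TangentSpace (𝓡 (2 * n + 1)) (c t) :=
  mfderiv 𝓘(ℝ, ℝ) (𝓡 (2 * n + 1)) c t (1 : ℝ)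

/-- A contactomorphism: a diffeomorphism that maps `ξ = ker α` onto itself. -/
def IsContactomorphism (α : ContactForm n M)
    (φ : M ≃ₘ^∞⟮𝓡 (2 * n + 1), 𝓡 (2 * n + 1)⟯ M) : Prop :=
  ∀ (x : M) (v : TangentSpace (𝓡 (2 * n + 1)) x),
    α.form (φ x) (mfderiv (𝓡 (2 * n + 1)) (𝓡 (2 * n + 1)) φ x v) = 0 ↔ α.form x v = 0

/-- A smooth path `(Φ t)`, `t ∈ [0,1]`, of contactomorphisms.  As for all paths below, smoothness
on `[0,1]` means being the restriction of a family that is smooth on `ℝ`; only the times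
`t ∈ [0,1]` matter. -/
def IsContactIsotopy (α : ContactForm n M) (Φ : ℝ → M → M) : Prop :=
  ContMDiff (𝓘(ℝ, ℝ).prod (𝓡 (2 * n + 1))) (𝓡 (2 * n + 1)) ∞ (fun q : ℝ × M => Φ q.1 q.2) ∧
  ∀ t ∈ Icc (0 : ℝ) 1, ∃ φ : M ≃ₘ^∞⟮𝓡 (2 * n + 1), 𝓡 (2 * n + 1)⟯ M,
    IsContactomorphism α φ ∧ ⇑φ = Φ t

/-- `Φ` is a smooth path of contactomorphisms from the identity to `φ`. -/
def IsContactIsotopyTo (α : ContactForm n M) (Φ : ℝ → M → M)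
    (φ : M ≃ₘ^∞⟮𝓡 (2 * n + 1), 𝓡 (2 * n + 1)⟯ M) : Prop :=
  IsContactIsotopy α Φ ∧ Φ 0 = id ∧ Φ 1 = ⇑φ

/-- `Cont₀(M)`: the contactomorphisms isotopic to the identity through contactomorphisms. -/
def Cont₀ (α : ContactForm n M) : Set (M ≃ₘ^∞⟮𝓡 (2 * n + 1), 𝓡 (2 * n + 1)⟯ M) :=
  {φ | ∃ Φ : ℝ → M → M, IsContactIsotopyTo α Φ φ}

/-- `∫₀¹ max_M |α(X_t)| dt`, where `X_t (Φ t x) = d/dt (Φ t x)`.  As `Φ t` is onto, the maximum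
over `M` may be taken over the points `Φ t x`. -/
def hoferLength (α : ContactForm n M) (Φ : ℝ → M → M) : ℝ :=
  ∫ t in (0 : ℝ)..1, ⨆ x : M, |α.form (Φ t x) (velocity n (fun s => Φ s x) t)|

/-- The Hofer–Shelukhin norm `|φ|_α`. -/
def hoferNorm (α : ContactForm n M)
    (φ : M ≃ₘ^∞⟮𝓡 (2 * n + 1), 𝓡 (2 * n + 1)⟯ M) : ENNReal :=
  ⨅ (Φ : ℝ → M → M) (_ : IsContactIsotopyTo α Φ φ), ENNReal.ofReal (hoferLength α Φ)

/-- The Rosen–Zhang (Chekanov-type) distance of two subsets of `M`, the infimum of the empty set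
being `∞`. -/
def rosenZhangDist (α : ContactForm n M) (L₀ L₁ : Set M) : ENNReal :=
  ⨅ (φ : M ≃ₘ^∞⟮𝓡 (2 * n + 1), 𝓡 (2 * n + 1)⟯ M) (_ : φ ∈ Cont₀ α) (_ : φ '' L₀ = L₁),
    hoferNorm α φ

variable {Λ : Type*} [TopologicalSpace Λ] [ChartedSpace (EuclideanSpace ℝ (Fin n)) Λ]

/-- A Legendrian embedding of an `n`-manifold `Λ` (used for compact `Λ` and Hausdorff `M`, where
an injective immersion is an embedding): a smooth injective immersion tangent to `ξ = ker α`. -/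
def IsLegendrianEmbedding (α : ContactForm n M) (f : Λ → M) : Prop :=
  ContMDiff (𝓡 n) (𝓡 (2 * n + 1)) ∞ f ∧ Function.Injective f ∧
  (∀ p, Function.Injective (mfderiv (𝓡 n) (𝓡 (2 * n + 1)) f p)) ∧
  ∀ (p : Λ) (v : TangentSpace (𝓡 n) p),
    α.form (f p) (mfderiv (𝓡 n) (𝓡 (2 * n + 1)) f p v) = 0

/-- A parametrised Legendrian isotopy `(l t)`, `t ∈ [0,1]`, from the submanifold `L₀` to the
submanifold `L₁`. -/
def IsLegendrianIsotopy (α : ContactForm n M) (l : ℝ → Λ → M) (L₀ L₁ : Set M) : Prop :=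
  ContMDiff (𝓘(ℝ, ℝ).prod (𝓡 n)) (𝓡 (2 * n + 1)) ∞ (fun q : ℝ × Λ => l q.1 q.2) ∧
  (∀ t ∈ Icc (0 : ℝ) 1, IsLegendrianEmbedding α (l t)) ∧
  range (l 0) = L₀ ∧ range (l 1) = L₁

/-- The Legendrian isotopy class of the closed Legendrian submanifold parametrised by `ι`. -/
abbrev LegendrianClass (α : ContactForm n M) (ι : Λ → M) : Type _ :=
  {L : Set M // ∃ l : ℝ → Λ → M, IsLegendrianIsotopy α l (range ι) L}

variable {α : ContactForm n M} {ι : Λ → M}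

/-- `L₀ ≪ L₁`: there is a positive Legendrian isotopy from `L₀` to `L₁`. -/
def PosRel (L₀ L₁ : LegendrianClass α ι) : Prop :=
  ∃ l : ℝ → Λ → M, IsLegendrianIsotopy α l L₀.1 L₁.1 ∧
    ∀ t ∈ Icc (0 : ℝ) 1, ∀ p, 0 < α.form (l t p) (velocity n (fun s => l s p) t)

/-- `L₀ ≼ L₁`: there is a non-negative Legendrian isotopy from `L₀` to `L₁`. -/
def NonnegRel (L₀ L₁ : LegendrianClass α ι) : Prop :=
  ∃ l : ℝ → Λ → M, IsLegendrianIsotopy α l L₀.1 L₁.1 ∧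
    ∀ t ∈ Icc (0 : ℝ) 1, ∀ p, 0 ≤ α.form (l t p) (velocity n (fun s => l s p) t)

/-- The isotopy class of `ι` is orderable if `≼` is a partial order on it. -/
def IsOrderable (α : ContactForm n M) (ι : Λ → M) : Prop :=
  IsPartialOrder (LegendrianClass α ι) NonnegRel

/-- `I⁺(L)`. -/
def chronFuture (L : LegendrianClass α ι) : Set (LegendrianClass α ι) := {K | PosRel L K}

/-- `I⁻(L)`. -/
def chronPast (L : LegendrianClass α ι) : Set (LegendrianClass α ι) := {K | PosRel K L}

/-- The interval topology, generated by the sets `I⁺(L₀) ∩ I⁻(L₁)`. -/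
@[reducible] def intervalTopology (α : ContactForm n M) (ι : Λ → M) :
    TopologicalSpace (LegendrianClass α ι) :=
  TopologicalSpace.generateFrom
    {U | ∃ L₀ L₁ : LegendrianClass α ι, U = chronFuture L₀ ∩ chronPast L₁}

/-- The topology induced by `d_α`: a set is open iff it contains, with each of its points, a
`d_α`-ball around that point. -/
@[reducible] def rosenZhangTopology (α : ContactForm n M) (ι : Λ → M) :
    TopologicalSpace (LegendrianClass α ι) where
  IsOpen U := ∀ L ∈ U, ∃ ε : ENNReal, 0 < ε ∧
    ∀ K : LegendrianClass α ι, rosenZhangDist α L.1 K.1 < ε → K ∈ U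
  isOpen_univ := fun _ _ => ⟨1, one_pos, fun _ _ => mem_univ _⟩
  isOpen_inter := by
    intro s t hs ht L hL
    obtain ⟨ε, hε, h⟩ := hs L hL.1
    obtain ⟨δ, hδ, h'⟩ := ht L hL.2
    exact ⟨min ε δ, lt_min hε hδ, fun K hK =>
      ⟨h K (hK.trans_le (min_le_left _ _)), h' K (hK.trans_le (min_le_right _ _))⟩⟩
  isOpen_sUnion := by
    intro S hS L hL
    obtain ⟨t, ht, hLt⟩ := hL
    obtain ⟨ε, hε, h⟩ := hS t ht L hLt
    exact ⟨ε, hε, fun K hK => ⟨t, ht, h K hK⟩⟩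

end

end Contact

end

/-! It suffices to show that `chronFuture` and `chronPast` are open for `rosenZhangTopology`, since
the interval topology is generated by intersections of these sets.

Let `l` be a positive isotopy from `L₀` to `L`. By compactness its velocity pairs with `α` to at
least some `δ > 0`. If `K` is close to `L`, there is a contact isotopy `Φ` from the identity, of
length less than `δ`, with `Φ 1 '' L = K`. Running `l` and then `Φ` joins `L₀` to `K`, but it may
move backwards during the second half, by a total amount below `δ`. The surplus `δ` of the first
half pays for this: composing with the Reeb flow at time `c t` adds exactly `deriv c t` to `α` of
the velocity, and leaves the ends fixed if `c 0 = c 1 = 0`. Such a `c` making everything positive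
exists because the deficit minus the surplus has negative integral (`exists_contDiff_lt_deriv`). For
the past, `Φ` is run backwards first and then `l` is run. Both cases are instances of
`exists_positive_isotopy`.

The rest constructs the Reeb flow for short times (`exists_smooth_reeb_family`). Smooth dependence
on initial values comes from the inverse function theorem applied to the integral equation in the
Banach space of continuous paths (`exists_smooth_flow_of_contDiff`). The flow `ρ` satisfies `ρ^*α =
ds + α` because the Lie derivative of `α` along the Reeb field vanishes (`flow_preserves_form`). -/

noncomputable section

namespace Contact

/-! ### Superposition operators on spaces of continuous functions. -/

section Nemytskii

variable {K : Type*} [TopologicalSpace K] [CompactSpace K]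

/-- Pointwise evaluation of a family of continuous linear maps on a family of vectors. -/
def pointwiseApply (K : Type*) [TopologicalSpace K] [CompactSpace K] (E F : Type*)
    [NormedAddCommGroup E] [NormedSpace ℝ E] [NormedAddCommGroup F] [NormedSpace ℝ F] :
    C(K, E →L[ℝ] F) →L[ℝ] C(K, E) →L[ℝ] C(K, F) :=
  LinearMap.mkContinuous₂
    (LinearMap.mk₂ ℝ
      (fun (A : C(K, E →L[ℝ] F)) (h : C(K, E)) => (⟨fun t => A t (h t), by fun_prop⟩ : C(K, F)))
      (by intros; ext; simp) (by intros; ext; simp) (by intros; ext; simp)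
      (by intros; ext; simp)) 1 (by
      intro A h
      rw [one_mul]
      refine (ContinuousMap.norm_le _ (by positivity)).2 fun t => ?_
      exact ((A t).le_opNorm _).trans (mul_le_mul (A.norm_coe_le_norm t) (h.norm_coe_le_norm t)
        (norm_nonneg _) (norm_nonneg A)))

@[simp]
theorem pointwiseApply_apply {E F : Type*}
    [NormedAddCommGroup E] [NormedSpace ℝ E] [NormedAddCommGroup F] [NormedSpace ℝ F]
    (A : C(K, E →L[ℝ] F)) (h : C(K, E)) (t : K) : pointwiseApply K E F A h t = A t (h t) := rfl

/-- A continuous map is continuous uniformly along a compact family of points. -/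
theorem exists_uniform_continuity_along {E F : Type*}
    [NormedAddCommGroup E] [NormedSpace ℝ E] [NormedAddCommGroup F]
    {g : E → F} (hg : Continuous g) (γ : C(K, E)) {ε : ℝ} (hε : 0 < ε) :
    ∃ δ > 0, ∀ t : K, ∀ h : E, ‖h‖ < δ → ‖g (γ t + h) - g (γ t)‖ ≤ ε := by
  have hc : Continuous fun η : C(K, E) => (ContinuousMap.mk g hg).comp η :=
    ContinuousMap.continuous_postcomp _
  obtain ⟨δ, hδ, H⟩ := Metric.continuous_iff.1 hc γ ε hε
  refine ⟨δ, hδ, fun t h hh => ?_⟩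
  -- A constant perturbation of the whole family already controls the values at a single `t`.
  have h1 : dist (γ + ContinuousMap.const K h) γ < δ := by
    rw [dist_eq_norm, add_sub_cancel_left]
    refine lt_of_le_of_lt ?_ hh
    exact (ContinuousMap.norm_le _ (norm_nonneg _)).2 fun _ => le_rfl
  have h3 := (ContinuousMap.dist_apply_le_dist (f := (ContinuousMap.mk g hg).comp
    (γ + ContinuousMap.const K h)) (g := (ContinuousMap.mk g hg).comp γ) t)
  rw [dist_eq_norm] at h3
  exact h3.trans (H _ h1).le

/-- Superposition with `f` is differentiable on continuous functions on a compact space. -/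
theorem hasFDerivAt_superposition {E F : Type*}
    [NormedAddCommGroup E] [NormedSpace ℝ E] [NormedAddCommGroup F] [NormedSpace ℝ F]
    {f : E → F} (hf : Differentiable ℝ f) (hf' : Continuous (fderiv ℝ f)) (γ : C(K, E)) :
    HasFDerivAt (fun η : C(K, E) => (ContinuousMap.mk f hf.continuous).comp η)
      (pointwiseApply K E F ((ContinuousMap.mk (fderiv ℝ f) hf').comp γ)) γ := by
  rw [hasFDerivAt_iff_isLittleO_nhds_zero, Asymptotics.isLittleO_iff]
  intro ε hε
  obtain ⟨δ, hδ, key⟩ := exists_uniform_continuity_along hf' γ hε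
  filter_upwards [Metric.ball_mem_nhds (0 : C(K, E)) hδ] with h hh
  refine (ContinuousMap.norm_le _ (by positivity)).2 fun t => ?_
  have hht : ‖h t‖ < δ := (h.norm_coe_le_norm t).trans_lt (mem_ball_zero_iff.1 hh)
  have h4 := Convex.norm_image_sub_le_of_norm_fderiv_le' (𝕜 := ℝ) (f := fun v => f (γ t + v))
    (s := Metric.ball (0 : E) δ) (φ := fderiv ℝ f (γ t)) (C := ε) (x := 0) (y := h t)
    (fun v _ => (hf _).comp v (by fun_prop))
    (fun v hv => by
      rw [fderiv_comp_add_left]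
      exact key t v (mem_ball_zero_iff.1 hv)) (convex_ball _ _) (Metric.mem_ball_self hδ) (mem_ball_zero_iff.2 hht)
  simp only [add_zero, sub_zero] at h4
  refine h4.trans ?_
  gcongr
  exact h.norm_coe_le_norm t

/-- The derivative of superposition with `f` is superposition with `fderiv ℝ f` followed by a
continuous linear map, so induction applies. The target changes from `F` to `E →L[ℝ] F`, which is
why the spaces are quantified inside and share one universe. -/
theorem contDiff_nat_superposition (n : ℕ) : ∀ {E F : Type u}
    [NormedAddCommGroup E] [NormedSpace ℝ E] [NormedAddCommGroup F] [NormedSpace ℝ F]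
    {f : E → F} (hf : ContDiff ℝ ∞ f),
    ContDiff ℝ n (fun η : C(K, E) => (ContinuousMap.mk f hf.continuous).comp η) := by
  induction n with
  | zero =>
    intro E F _ _ _ _ f hf
    exact contDiff_zero.2 (ContinuousMap.continuous_postcomp _)
  | succ n ih =>
    intro E F _ _ _ _ f hf
    have hf' : ContDiff ℝ ∞ (fderiv ℝ f) := hf.fderiv_right (by simp)
    refine contDiff_succ_iff_hasFDerivAt.2 ⟨fun γ => pointwiseApply K E F
      ((ContinuousMap.mk (fderiv ℝ f) hf'.continuous).comp γ), ?_, fun γ =>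
        hasFDerivAt_superposition (hf.differentiable (by simp)) hf'.continuous γ⟩
    exact (pointwiseApply K E F).contDiff.comp (ih hf')

/-- Superposition with a smooth map is smooth on continuous functions on a compact space. -/
theorem contDiff_superposition {E F : Type u}
    [NormedAddCommGroup E] [NormedSpace ℝ E] [NormedAddCommGroup F] [NormedSpace ℝ F]
    {f : E → F} (hf : ContDiff ℝ ∞ f) :
    ContDiff ℝ ∞ (fun η : C(K, E) => (ContinuousMap.mk f hf.continuous).comp η) :=
  contDiff_infty.2 fun n => contDiff_nat_superposition n hf

end Nemytskii

/-! ### Inverse function theorem. -/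

section SmoothInverse

/-- The smooth inverse function theorem, with smoothness of the inverse on a neighbourhood. -/
theorem exists_openPartialHomeomorph_contDiffAt_symm {X Y : Type*} [NormedAddCommGroup X]
    [NormedSpace ℝ X] [CompleteSpace X] [NormedAddCommGroup Y] [NormedSpace ℝ Y]
    {G : X → Y} (hG : ContDiff ℝ ∞ G) {a : X} {G' : X ≃L[ℝ] Y}
    (ha : HasFDerivAt G (G' : X →L[ℝ] Y) a) :
    ∃ e : OpenPartialHomeomorph X Y, ⇑e = G ∧ a ∈ e.source ∧
      ∀ᶠ b in 𝓝 (G a), ContDiffAt ℝ ∞ e.symm b := by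
  refine ⟨hG.contDiffAt.toOpenPartialHomeomorph G ha (by simp), rfl,
    ContDiffAt.mem_toOpenPartialHomeomorph_source hG.contDiffAt ha (by simp), ?_⟩
  set e := hG.contDiffAt.toOpenPartialHomeomorph G ha (by simp) with he
  have hae : a ∈ e.source :=
    ContDiffAt.mem_toOpenPartialHomeomorph_source hG.contDiffAt ha (by simp)
  have heG : ⇑e = G := rfl
  -- Invertible operators form an open set, so the derivative stays invertible near `a`.
  have h1 : ∀ᶠ x in 𝓝 a, fderiv ℝ G x ∈ range ((↑) : (X ≃L[ℝ] Y) → X →L[ℝ] Y) := by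
    have hc : ContinuousAt (fderiv ℝ G) a := (hG.continuous_fderiv (by simp)).continuousAt
    apply hc.eventually
    rw [ha.fderiv]
    exact ContinuousLinearEquiv.nhds G'
  have hat : G a ∈ e.target := e.map_source hae
  have h2 : Filter.Tendsto e.symm (𝓝 (G a)) (𝓝 a) := e.tendsto_symm hae
  filter_upwards [h2.eventually h1, e.open_target.mem_nhds hat] with b ⟨A, hA⟩ hb
  refine e.contDiffAt_symm hb (f₀' := A) ?_ hG.contDiffAt
  rw [hA]
  exact (hG.differentiable (by simp) _).hasFDerivAt

end SmoothInverse

/-! ### Smooth dependence of flows on time and initial value. -/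

section SmoothFlow

variable {E : Type u} [NormedAddCommGroup E] [NormedSpace ℝ E]

/-- The primitive vanishing at `0` of a continuous function on `[0,1]`. -/
def unitPrimitive (E : Type*) [NormedAddCommGroup E] [NormedSpace ℝ E] :
    C(unitInterval, E) →L[ℝ] C(unitInterval, E) :=
  LinearMap.mkContinuous
    { toFun := fun η => ⟨fun t => ∫ u in (0 : ℝ)..t, IccExtend zero_le_one η u, by
        have h : Continuous (IccExtend zero_le_one η) := η.continuous.Icc_extend'
        exact (intervalIntegral.continuous_primitive
          (fun a b => h.intervalIntegrable a b) 0).comp continuous_subtype_val⟩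
      map_add' := by
        intro η θ
        ext t
        have h : Continuous (IccExtend zero_le_one η) := η.continuous.Icc_extend'
        have h' : Continuous (IccExtend zero_le_one θ) := θ.continuous.Icc_extend'
        exact intervalIntegral.integral_add (h.intervalIntegrable _ _) (h'.intervalIntegrable _ _)
      map_smul' := by
        intro c η
        ext t
        exact intervalIntegral.integral_smul c _ } 1 (by
    intro η
    refine (ContinuousMap.norm_le _ (by positivity)).2 fun t => ?_
    refine (intervalIntegral.norm_integral_le_of_norm_le_const (C := ‖η‖) fun u _ => ?_).trans ?_
    · exact η.norm_coe_le_norm _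
    · rw [one_mul, sub_zero, abs_of_nonneg t.2.1]
      exact mul_le_of_le_one_right (norm_nonneg η) t.2.2)

theorem unitPrimitive_apply {E : Type*} [NormedAddCommGroup E] [NormedSpace ℝ E]
    (η : C(unitInterval, E)) (t : unitInterval) :
    unitPrimitive E η t = ∫ u in (0 : ℝ)..t, IccExtend zero_le_one η u := rfl

/-- The inclusion of the constant paths. -/
def constPath (E : Type*) [NormedAddCommGroup E] [NormedSpace ℝ E] :
    E →L[ℝ] C(unitInterval, E) :=
  LinearMap.mkContinuous
    { toFun := fun x => ContinuousMap.const _ x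
      map_add' := fun _ _ => rfl
      map_smul' := fun _ _ => rfl } 1 (by
    intro x
    rw [one_mul]
    exact (ContinuousMap.norm_le _ (norm_nonneg x)).2 fun _ => le_rfl)

@[simp]
theorem constPath_apply {E : Type*} [NormedAddCommGroup E] [NormedSpace ℝ E] (x : E)
    (t : unitInterval) : constPath E x t = x := rfl

/-- The map whose zeros `γ` are the rescaled solutions `γ t = x + τ ∫₀ᵗ f (γ u) du`. -/
def integralEquation (f : C(E, E)) (p : ℝ × E × C(unitInterval, E)) :
    ℝ × E × C(unitInterval, E) :=
  (p.1, p.2.1, p.2.2 - constPath E p.2.1 - p.1 • unitPrimitive E (f.comp p.2.2))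

theorem contDiff_integralEquation (f : C(E, E)) (hf : ContDiff ℝ ∞ f) :
    ContDiff ℝ ∞ (integralEquation f) := by
  have h : ContDiff ℝ ∞ (fun η : C(unitInterval, E) => f.comp η) := contDiff_superposition hf
  unfold integralEquation
  have h1 : ContDiff ℝ ∞ (fun p : ℝ × E × C(unitInterval, E) => f.comp p.2.2) :=
    h.comp (contDiff_snd.comp contDiff_snd)
  refine contDiff_fst.prodMk ((contDiff_fst.comp contDiff_snd).prodMk (ContDiff.sub (ContDiff.sub
    (contDiff_snd.comp contDiff_snd) ((constPath E).contDiff.comp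
      (contDiff_fst.comp contDiff_snd))) (contDiff_fst.smul ((unitPrimitive E).contDiff.comp h1))))

/-- The derivative of `integralEquation` at time `0`. -/
def integralEquationDeriv (v : C(unitInterval, E)) :
    (ℝ × E × C(unitInterval, E)) ≃L[ℝ] (ℝ × E × C(unitInterval, E)) :=
  ContinuousLinearEquiv.equivOfInverse
    ((ContinuousLinearMap.fst ℝ _ _).prod (((ContinuousLinearMap.fst ℝ _ _).comp
      (ContinuousLinearMap.snd ℝ _ _)).prod (((ContinuousLinearMap.snd ℝ _ _).comp
      (ContinuousLinearMap.snd ℝ _ _)) - (constPath E).comp ((ContinuousLinearMap.fst ℝ _ _).comp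
      (ContinuousLinearMap.snd ℝ _ _)) - (ContinuousLinearMap.fst ℝ _ _).smulRight v)))
    ((ContinuousLinearMap.fst ℝ _ _).prod (((ContinuousLinearMap.fst ℝ _ _).comp
      (ContinuousLinearMap.snd ℝ _ _)).prod (((ContinuousLinearMap.snd ℝ _ _).comp
      (ContinuousLinearMap.snd ℝ _ _)) + (constPath E).comp ((ContinuousLinearMap.fst ℝ _ _).comp
      (ContinuousLinearMap.snd ℝ _ _)) + (ContinuousLinearMap.fst ℝ _ _).smulRight v)))
    (by rintro ⟨τ, x, η⟩; ext <;> simp; abel) (by rintro ⟨τ, x, η⟩; ext <;> simp; abel)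

/-- At `τ = 0` the derivative of the integral term in the path direction is killed by the factor
`τ`. What remains is unipotent, hence invertible without any smallness condition on `f`. -/
theorem hasFDerivAt_integralEquation (f : C(E, E)) (hf : ContDiff ℝ ∞ f) (x : E) :
    HasFDerivAt (integralEquation f) (integralEquationDeriv (unitPrimitive E
      (f.comp (constPath E x))) : _ →L[ℝ] _) (0, x, constPath E x) := by
  have h : ContDiff ℝ ∞ (fun p : ℝ × E × C(unitInterval, E) => unitPrimitive E (f.comp p.2.2)) :=
    (unitPrimitive E).contDiff.comp ((contDiff_superposition hf).comp
      (contDiff_snd.comp contDiff_snd))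
  have h1 := (h.differentiable (by simp) (0, x, constPath E x)).hasFDerivAt
  have h2 := (hasFDerivAt_fst (𝕜 := ℝ) (p := ((0 : ℝ), x, constPath E x))).smul h1
  have h3 := (hasFDerivAt_snd (𝕜 := ℝ) (p := ((0 : ℝ), x, constPath E x)))
  have h4 := h3.fst
  have h5 := h3.snd
  have h6 := (constPath E).hasFDerivAt.comp _ h4
  have h7 := (hasFDerivAt_fst (𝕜 := ℝ) (p := ((0 : ℝ), x, constPath E x))).prodMk
    (h4.prodMk ((h5.sub h6).sub h2))
  refine h7.congr_fderiv ?_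
  ext <;> simp [integralEquationDeriv]

theorem integralEquation_eq_of_hasDerivAt [CompleteSpace E] (f : C(E, E)) {τ : ℝ} {x : E} {y : ℝ → E}
    (hy : ∀ u ∈ Icc (0 : ℝ) 1, HasDerivAt y (f (y (τ * u))) (τ * u)) (h0 : y 0 = x)
    (P : C(unitInterval, E)) (hP : ∀ t : unitInterval, P t = y (τ * t)) :
    integralEquation f (τ, x, P) = (τ, x, 0) := by
  have key : P - constPath E x - τ • unitPrimitive E (f.comp P) = 0 := by
    ext t
    have hsub : ∀ u ∈ uIcc (0 : ℝ) t, u ∈ Icc (0 : ℝ) 1 := by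
      intro u hu
      rw [uIcc_of_le t.2.1] at hu
      exact ⟨hu.1, hu.2.trans t.2.2⟩
    have hd : ∀ u ∈ uIcc (0 : ℝ) t, HasDerivAt (fun u => y (τ * u))
        (τ • IccExtend zero_le_one (f.comp P) u) u := by
      intro u hu
      have h1 := (hy u (hsub u hu)).scomp u ((hasDerivAt_id u).const_mul τ)
      rw [IccExtend_of_mem _ _ (hsub u hu)]
      simpa [hP, Function.comp_def] using h1
    have hc : Continuous (IccExtend zero_le_one (f.comp P)) := (f.comp P).continuous.Icc_extend'
    have h2 := intervalIntegral.integral_eq_sub_of_hasDerivAt hd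
      ((hc.const_smul τ).intervalIntegrable _ _)
    rw [intervalIntegral.integral_smul] at h2
    simp only [ContinuousMap.sub_apply, ContinuousMap.smul_apply, unitPrimitive_apply, h2, hP,
      constPath_apply, mul_zero, h0, sub_self, ContinuousMap.zero_apply]
  simp only [integralEquation, key]

/-- The local flow of a smooth vector field is smooth. -/
theorem exists_smooth_flow_of_contDiff [CompleteSpace E] {f : E → E} (hf : ContDiff ℝ ∞ f) (x₀ : E) :
    ∃ r > 0, ∃ g : ℝ × E → E,
      (∀ p ∈ Metric.ball (0 : ℝ) r ×ˢ Metric.ball x₀ r, ContDiffAt ℝ ∞ g p) ∧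
      ∀ x ∈ Metric.ball x₀ r, g (0, x) = x ∧
        ∀ s ∈ Metric.ball (0 : ℝ) r, HasDerivAt (fun s => g (s, x)) (f (g (s, x))) s := by
  obtain ⟨e, he, hae, hsm⟩ := exists_openPartialHomeomorph_contDiffAt_symm
    (contDiff_integralEquation ⟨f, hf.continuous⟩ hf)
    (hasFDerivAt_integralEquation ⟨f, hf.continuous⟩ hf x₀)
  obtain ⟨T, hT, a, ρ, L, Kc, hρ, hPL⟩ := IsPicardLindelof.of_contDiffAt_one
    (hf.contDiffAt (x := x₀) |>.of_le (by simp : (1 : WithTop ℕ∞) ≤ ∞))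
  obtain ⟨α, hα, hαc⟩ :=
    (hPL 0).exists_forall_mem_closedBall_eq_hasDerivWithinAt_continuousOn
  simp only [zero_sub, zero_add] at hα hαc
  have hαd : ∀ x ∈ Metric.closedBall x₀ ρ, ∀ s ∈ Ioo (-T) T,
      HasDerivAt (fun s => α (x, s)) (f (α (x, s))) s := fun x hx s hs =>
    ((hα x hx).2 s (Ioo_subset_Icc_self hs)).hasDerivAt (Icc_mem_nhds hs.1 hs.2)
  obtain ⟨δ, hδ, hsrc⟩ := Metric.isOpen_iff.1 e.open_source _ hae
  have hG0 : integralEquation ⟨f, hf.continuous⟩ ((0 : ℝ), x₀, constPath E x₀) = (0, x₀, 0) := by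
    simp [integralEquation]
  rw [hG0] at hsm
  obtain ⟨δ', hδ', hsm'⟩ := Metric.eventually_nhds_iff.1 hsm
  have hx₀ : α (x₀, 0) = x₀ := (hα x₀ (Metric.mem_closedBall_self ρ.2)).1
  -- The bound is `δ / 2` because a supremum of pointwise strict bounds is only bounded weakly.
  have hnear : ∀ᶠ q in 𝓝 (x₀, (0 : ℝ)), dist (α q) x₀ < δ / 2 := by
    have hca : ContinuousAt α (x₀, (0 : ℝ)) := hαc.continuousAt
      (prod_mem_nhds (Metric.closedBall_mem_nhds _ hρ) (Icc_mem_nhds (by linarith) hT))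
    rw [ContinuousAt, hx₀] at hca
    exact hca (Metric.ball_mem_nhds _ (half_pos hδ))
  obtain ⟨η, hη, hnear'⟩ := Metric.eventually_nhds_iff.1 hnear
  set r := min (min T ρ) (min (min δ δ') η) with hr
  have hr0 : 0 < r := by
    have : (0 : ℝ) < ρ := hρ
    simp only [hr, lt_min_iff]
    exact ⟨⟨hT, this⟩, ⟨hδ, hδ'⟩, hη⟩
  have hrT : r ≤ T := (min_le_left _ _).trans (min_le_left _ _)
  have hrρ : r ≤ ρ := (min_le_left _ _).trans (min_le_right _ _)
  have hrδ : r ≤ δ := (min_le_right _ _).trans ((min_le_left _ _).trans (min_le_left _ _))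
  have hrδ' : r ≤ δ' := (min_le_right _ _).trans ((min_le_left _ _).trans (min_le_right _ _))
  have hrη : r ≤ η := (min_le_right _ _).trans (min_le_right _ _)
  -- The rescaled Picard–Lindelöf solution solves the integral equation and lies in `e.source`, so
  -- it is the path that `e.symm` returns. Its value at parameter `1` is the flow at time `τ`, which
  -- transfers smoothness from `e.symm` to the flow.
  have hEq : ∀ τ ∈ Metric.ball (0 : ℝ) r, ∀ x ∈ Metric.ball x₀ r,
      (e.symm (τ, x, 0)).2.2 1 = α (x, τ) := by
    intro τ hτ x hx
    have hx' : x ∈ Metric.closedBall x₀ ρ :=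
      Metric.ball_subset_closedBall (Metric.ball_subset_ball hrρ hx)
    rw [mem_ball_zero_iff, Real.norm_eq_abs] at hτ
    have hτu : ∀ u ∈ Icc (0 : ℝ) 1, |τ * u| < r := by
      intro u hu
      rw [abs_mul, abs_of_nonneg hu.1]
      exact (mul_le_of_le_one_right (abs_nonneg τ) hu.2).trans_lt hτ
    have hτT : ∀ u ∈ Icc (0 : ℝ) 1, τ * u ∈ Ioo (-T) T := fun u hu =>
      abs_lt.1 ((hτu u hu).trans_le hrT)
    have hcont : Continuous fun t : unitInterval => α (x, τ * t) := by
      refine continuous_iff_continuousAt.2 fun t => ?_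
      exact (hαd x hx' _ (hτT t t.2)).continuousAt.comp (f := fun t : unitInterval => τ * (t : ℝ))
        (by fun_prop)
    set P : C(unitInterval, E) := ⟨_, hcont⟩ with hP
    have h1 : integralEquation ⟨f, hf.continuous⟩ (τ, x, P) = (τ, x, 0) :=
      integralEquation_eq_of_hasDerivAt ⟨f, hf.continuous⟩ (y := fun s => α (x, s))
        (fun u hu => hαd x hx' _ (hτT u hu)) (hα x hx').1 P fun t => rfl
    have h2 : (τ, x, P) ∈ e.source := by
      apply hsrc
      rw [Metric.mem_ball, Prod.dist_eq, Prod.dist_eq, max_lt_iff, max_lt_iff]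
      refine ⟨?_, lt_of_lt_of_le hx hrδ, ?_⟩
      · simpa [Real.dist_eq] using hτ.trans_le hrδ
      · refine lt_of_le_of_lt ((ContinuousMap.dist_le (half_pos hδ).le).2 fun t => ?_)
          (half_lt_self hδ)
        refine (hnear' ?_).le
        rw [Prod.dist_eq, max_lt_iff]
        exact ⟨lt_of_lt_of_le hx hrη, by simpa [Real.dist_eq] using (hτu t t.2).trans_le hrη⟩
    have h3 : e.symm (τ, x, 0) = (τ, x, P) := by
      rw [← h1, ← he, e.left_inv h2]
    rw [h3]
    simp [hP]
  refine ⟨r, hr0, fun p => (e.symm (p.1, p.2, 0)).2.2 1, ?_, ?_⟩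
  · rintro ⟨τ, x⟩ ⟨hτ, hx⟩
    have h1 : ContDiffAt ℝ ∞ e.symm (τ, x, 0) := by
      apply hsm'
      rw [Prod.dist_eq, Prod.dist_eq, max_lt_iff, max_lt_iff]
      exact ⟨lt_of_lt_of_le hτ hrδ', lt_of_lt_of_le hx hrδ', by simpa using hδ'⟩
    have h2 : ContDiffAt ℝ ∞ (fun p : ℝ × E => e.symm (p.1, p.2, (0 : C(unitInterval, E))))
        (τ, x) :=
      h1.comp (τ, x) (f := fun p : ℝ × E => (p.1, p.2, (0 : C(unitInterval, E)))) (by fun_prop)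
    exact (ContinuousMap.evalCLM ℝ (1 : unitInterval)).contDiff.contDiffAt.comp (τ, x)
      h2.snd.snd
  · intro x hx
    have hx' : x ∈ Metric.closedBall x₀ ρ :=
      Metric.ball_subset_closedBall (Metric.ball_subset_ball hrρ hx)
    refine ⟨?_, fun s hs => ?_⟩
    · simp only [hEq 0 (Metric.mem_ball_self hr0) x hx]
      exact (hα x hx').1
    · have hsT : s ∈ Ioo (-T) T := by
        rw [mem_ball_zero_iff, Real.norm_eq_abs] at hs
        exact abs_lt.1 (hs.trans_le hrT)
      simp only [hEq s hs x hx]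
      refine (hαd x hx' s hsT).congr_of_eventuallyEq ?_
      filter_upwards [Metric.isOpen_ball.mem_nhds hs] with s' hs'
      exact hEq s' hs' x hx

/-- The local flow of a vector field that is smooth near `x₀`. -/
theorem exists_smooth_local_flow [CompleteSpace E] [FiniteDimensional ℝ E] {f : E → E} {x₀ : E} {U : Set E}
    (hU : U ∈ 𝓝 x₀) (hf : ∀ x ∈ U, ContDiffAt ℝ ∞ f x) :
    ∃ r > 0, ∃ g : ℝ × E → E,
      (∀ p ∈ Metric.ball (0 : ℝ) r ×ˢ Metric.ball x₀ r, ContDiffAt ℝ ∞ g p ∧ g p ∈ U) ∧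
      ∀ x ∈ Metric.ball x₀ r, g (0, x) = x ∧
        ∀ s ∈ Metric.ball (0 : ℝ) r, HasDerivAt (fun s => g (s, x)) (f (g (s, x))) s := by
  obtain ⟨R, hR, hRU⟩ := Metric.nhds_basis_closedBall.mem_iff.1 hU
  let b : ContDiffBump x₀ := ⟨R / 2, R, half_pos hR, half_lt_self hR⟩
  have hb : ContDiff ℝ ∞ fun x => b x • f x := by
    refine contDiff_iff_contDiffAt.2 fun x => ?_
    by_cases hx : x ∈ U
    · exact b.contDiff.contDiffAt.smul (hf x hx)
    · have hx' : x ∉ tsupport b := by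
        rw [b.tsupport_eq]
        exact fun h => hx (hRU h)
      have h0 : (fun x => b x • f x) =ᶠ[𝓝 x] fun _ => 0 := by
        filter_upwards [notMem_tsupport_iff_eventuallyEq.1 hx'] with y hy
        rw [hy]
        simp
      exact contDiffAt_const.congr_of_eventuallyEq h0
  obtain ⟨r, hr, g, hg, hg'⟩ := exists_smooth_flow_of_contDiff hb x₀
  have hc : ContinuousAt g (0, x₀) :=
    (hg (0, x₀) ⟨Metric.mem_ball_self hr, Metric.mem_ball_self hr⟩).continuousAt
  have hmem : ∀ᶠ p in 𝓝 ((0 : ℝ), x₀), g p ∈ Metric.ball x₀ (R / 2) := by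
    apply hc
    rw [(hg' x₀ (Metric.mem_ball_self hr)).1]
    exact Metric.ball_mem_nhds _ (half_pos hR)
  obtain ⟨r', hr', hmem'⟩ := Metric.eventually_nhds_iff.1 hmem
  -- The flow is kept where the bump is `1`, so the cut-off field coincides with `f` along it.
  have hlt : ∀ p ∈ Metric.ball (0 : ℝ) (min r r') ×ˢ Metric.ball x₀ (min r r'),
      g p ∈ Metric.ball x₀ (R / 2) := by
    rintro ⟨s, x⟩ ⟨hs, hx⟩
    apply hmem'
    rw [Prod.dist_eq, max_lt_iff]
    exact ⟨lt_of_lt_of_le hs (min_le_right _ _), lt_of_lt_of_le hx (min_le_right _ _)⟩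
  refine ⟨min r r', lt_min hr hr', g, ?_, ?_⟩
  · intro p hp
    refine ⟨hg p ⟨Metric.ball_subset_ball (min_le_left _ _) hp.1,
      Metric.ball_subset_ball (min_le_left _ _) hp.2⟩, hRU ?_⟩
    exact Metric.ball_subset_closedBall (Metric.ball_subset_ball (half_le_self hR.le) (hlt p hp))
  · intro x hx
    obtain ⟨h1, h2⟩ := hg' x (Metric.ball_subset_ball (min_le_left _ _) hx)
    refine ⟨h1, fun s hs => ?_⟩
    have h3 := h2 s (Metric.ball_subset_ball (min_le_left _ _) hs)
    have h4 : b (g (s, x)) = 1 :=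
      b.one_of_mem_closedBall (Metric.ball_subset_closedBall (hlt (s, x) ⟨hs, hx⟩))
    rwa [h4, one_smul] at h3

end SmoothFlow

/-! ### The Reeb field of a contact form on a normed space. -/

section ReebVectorField

variable {E : Type*} [NormedAddCommGroup E] [NormedSpace ℝ E]

theorem contDiff_flip : ContDiff ℝ ∞ (fun A : E →L[ℝ] E →L[ℝ] ℝ => A.flip) := by
  have h : IsBoundedLinearMap ℝ (fun A : E →L[ℝ] E →L[ℝ] ℝ => A.flip) := by
    refine ⟨⟨fun _ _ => rfl, fun _ _ => rfl⟩, 1, one_pos, fun A => ?_⟩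
    rw [one_mul]
    refine ContinuousLinearMap.opNorm_le_bound _ (norm_nonneg A) fun v => ?_
    refine ContinuousLinearMap.opNorm_le_bound _ (by positivity) fun w => ?_
    rw [ContinuousLinearMap.flip_apply]
    have := A.le_opNorm₂ w v
    linarith [mul_right_comm ‖A‖ ‖v‖ ‖w‖]
  exact h.contDiff

/-- The exterior derivative of a `1`-form on a normed space, as a bilinear form. -/
def dForm (a : E → E →L[ℝ] ℝ) (y : E) : E →L[ℝ] E →L[ℝ] ℝ :=
  fderiv ℝ a y - (fderiv ℝ a y).flip

@[simp]
theorem dForm_apply (a : E → E →L[ℝ] ℝ) (y v w : E) :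
    dForm a y v w = fderiv ℝ a y v w - fderiv ℝ a y w v := rfl

/-- A `1`-form on a normed space is a contact form at the point `y`. -/
def IsContactAt (a : E → E →L[ℝ] ℝ) (y : E) : Prop :=
  a y ≠ 0 ∧ ∀ v, a y v = 0 → (∀ w, a y w = 0 → dForm a y v w = 0) → v = 0

/-- The bilinear form `da + a ⊗ a`. -/
def contactPairing (a : E → E →L[ℝ] ℝ) (y : E) : E →L[ℝ] E →L[ℝ] ℝ :=
  dForm a y + (a y).smulRight (a y)

@[simp]
theorem contactPairing_apply (a : E → E →L[ℝ] ℝ) (y v w : E) :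
    contactPairing a y v w = dForm a y v w + a y v * a y w := by
  simp [contactPairing]

/-- The Reeb vector field of a contact form on a normed space. -/
def localReeb (a : E → E →L[ℝ] ℝ) (y : E) : E := (contactPairing a y).inverse (a y)

/-- As `da` is skew, pairing `v` with itself gives `(a v)²`. So a kernel vector lies in `ker a`, and
there the pairing reduces to `da`. -/
theorem IsContactAt.contactPairing_injective {a : E → E →L[ℝ] ℝ} {y : E} (h : IsContactAt a y) :
    Function.Injective (contactPairing a y) := by
  refine (injective_iff_map_eq_zero _).2 fun v hv => ?_
  have h0 : a y v = 0 := by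
    have h1 : contactPairing a y v v = 0 := by rw [hv]; rfl
    simpa using h1
  refine h.2 v h0 fun w _ => ?_
  have h1 : contactPairing a y v w = 0 := by rw [hv]; rfl
  rwa [contactPairing_apply, h0, zero_mul, add_zero] at h1

theorem IsContactAt.exists_equiv [FiniteDimensional ℝ E] {a : E → E →L[ℝ] ℝ} {y : E}
    (h : IsContactAt a y) : ∃ e : E ≃L[ℝ] (E →L[ℝ] ℝ), (e : E →L[ℝ] E →L[ℝ] ℝ) =
      contactPairing a y := by
  have hf : Module.finrank ℝ E = Module.finrank ℝ (E →L[ℝ] ℝ) := by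
    rw [← (LinearMap.toContinuousLinearMap (𝕜 := ℝ) (E := E) (F' := ℝ)).finrank_eq]
    exact (Subspace.dual_finrank_eq).symm
  refine ⟨(LinearEquiv.ofInjectiveOfFinrankEq (contactPairing a y : E →ₗ[ℝ] E →L[ℝ] ℝ)
    h.contactPairing_injective hf).toContinuousLinearEquiv, ?_⟩
  ext v w
  rfl

theorem IsContactAt.contactPairing_localReeb [FiniteDimensional ℝ E] {a : E → E →L[ℝ] ℝ} {y : E}
    (h : IsContactAt a y) : contactPairing a y (localReeb a y) = a y := by
  obtain ⟨e, he⟩ := h.exists_equiv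
  rw [localReeb, ← he, ContinuousLinearMap.inverse_equiv]
  simp

/-- Pairing the field `R` with itself gives `a(R)² = a(R)`. The value `0` would force `R = 0` by
nondegeneracy, hence `a = 0`. -/
theorem IsContactAt.apply_localReeb [FiniteDimensional ℝ E] {a : E → E →L[ℝ] ℝ} {y : E}
    (h : IsContactAt a y) : a y (localReeb a y) = 1 := by
  have h1 := h.contactPairing_localReeb
  have h2 : contactPairing a y (localReeb a y) (localReeb a y) = a y (localReeb a y) := by rw [h1]
  rw [contactPairing_apply, dForm_apply, sub_self, zero_add] at h2
  by_cases h0 : a y (localReeb a y) = 0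
  · exfalso
    have h3 : localReeb a y = 0 := by
      refine h.2 _ h0 fun w hw => ?_
      have h4 : contactPairing a y (localReeb a y) w = a y w := by rw [h1]
      rwa [contactPairing_apply, h0, zero_mul, add_zero, hw] at h4
    rw [h3, map_zero] at h1
    exact h.1 h1.symm
  · exact mul_right_cancel₀ h0 (by rw [h2, one_mul])

theorem IsContactAt.dForm_localReeb [FiniteDimensional ℝ E] {a : E → E →L[ℝ] ℝ} {y : E}
    (h : IsContactAt a y) (w : E) : dForm a y (localReeb a y) w = 0 := by
  have h1 : contactPairing a y (localReeb a y) w = a y w := by rw [h.contactPairing_localReeb]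
  rw [contactPairing_apply, h.apply_localReeb] at h1
  linarith

theorem IsContactAt.eq_localReeb [FiniteDimensional ℝ E] {a : E → E →L[ℝ] ℝ} {y : E}
    (h : IsContactAt a y) {v : E} (hv : a y v = 1) (hv' : ∀ w, dForm a y v w = 0) :
    v = localReeb a y := by
  apply h.contactPairing_injective
  ext w
  rw [contactPairing_apply, contactPairing_apply, hv, hv', h.apply_localReeb, h.dForm_localReeb]

theorem IsContactAt.contDiffAt_localReeb [FiniteDimensional ℝ E] {a : E → E →L[ℝ] ℝ} {y : E}
    (h : IsContactAt a y) (ha : ContDiffAt ℝ ∞ a y) : ContDiffAt ℝ ∞ (localReeb a) y := by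
  have : CompleteSpace E := FiniteDimensional.complete ℝ E
  obtain ⟨e, he⟩ := h.exists_equiv
  have h1 : ContDiffAt ℝ ∞ (fderiv ℝ a) y := ha.fderiv_right (by simp)
  have h2 : ContDiffAt ℝ ∞ (contactPairing a) y := by
    have h3 : ContDiffAt ℝ ∞ (fun y => (fderiv ℝ a y).flip) y :=
      contDiff_flip.contDiffAt.comp y h1
    have h4 : ContDiffAt ℝ ∞ (fun y => (a y).smulRight (a y)) y :=
      ha.smulRight ha
    exact (h1.sub h3).add h4
  have h5 : ContDiffAt ℝ ∞ (fun y => (contactPairing a y).inverse) y := by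
    have h6 := contDiffAt_map_inverse (n := ∞) e
    rw [he] at h6
    exact h6.comp y h2
  exact h5.clm_apply ha

/-- The derivative of a Reeb flow in the space directions preserves the contact form. -/
theorem flow_preserves_form {a : E → E →L[ℝ] ℝ} {R : E → E} {U : Set E} (hU : IsOpen U)
    (ha : ∀ y ∈ U, ContDiffAt ℝ ∞ a y) (hR : ∀ y ∈ U, ContDiffAt ℝ ∞ R y)
    (haR : ∀ y ∈ U, a y (R y) = 1) (hdR : ∀ y ∈ U, ∀ w, dForm a y (R y) w = 0)
    {g : ℝ × E → E} {y₀ : E} {r : ℝ}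
    (hg : ∀ p ∈ Metric.ball (0 : ℝ) r ×ˢ Metric.ball y₀ r, ContDiffAt ℝ ∞ g p ∧ g p ∈ U)
    (hg' : ∀ y ∈ Metric.ball y₀ r, g (0, y) = y ∧
      ∀ s ∈ Metric.ball (0 : ℝ) r, HasDerivAt (fun s => g (s, y)) (R (g (s, y))) s)
    {s : ℝ} (hs : s ∈ Metric.ball (0 : ℝ) r) {y : E} (hy : y ∈ Metric.ball y₀ r) (σ : ℝ) (w : E) :
    a (g (s, y)) (fderiv ℝ g (s, y) (σ, w)) = σ + a y w := by
  have hd : ∀ p ∈ Metric.ball (0 : ℝ) r ×ˢ Metric.ball y₀ r, HasFDerivAt g (fderiv ℝ g p) p :=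
    fun p hp => ((hg p hp).1.differentiableAt (by simp)).hasFDerivAt
  have hslice : ∀ {F : Type _} [NormedAddCommGroup F] [NormedSpace ℝ F] {k : ℝ × E → F}
      {k' : ℝ × E →L[ℝ] F} {s : ℝ}, HasFDerivAt k k' (s, y) →
      HasDerivAt (fun s => k (s, y)) (k' (1, 0)) s := by
    intro F _ _ k k' s hk
    exact hk.comp_hasDerivAt s ((hasDerivAt_id s).prodMk (hasDerivAt_const s y))
  have htime : ∀ p ∈ Metric.ball (0 : ℝ) r ×ˢ Metric.ball y₀ r, fderiv ℝ g p (1, 0) = R (g p) := by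
    rintro ⟨s, z⟩ hp
    have h1 := (hd _ hp).comp_hasDerivAt s ((hasDerivAt_id s).prodMk (hasDerivAt_const s z))
    exact h1.unique ((hg' z hp.2).2 s hp.1)
  have hopen : IsOpen (Metric.ball (0 : ℝ) r ×ˢ Metric.ball y₀ r) :=
    Metric.isOpen_ball.prod Metric.isOpen_ball
  -- This is Cartan's formula `L_R a = d(a(R)) + i_R da = 0`, written out along the flow.
  have hconst : ∀ s ∈ Metric.ball (0 : ℝ) r,
      HasDerivAt (fun s => a (g (s, y)) (fderiv ℝ g (s, y) (0, w))) 0 s := by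
    intro s hs
    have hp : (s, y) ∈ Metric.ball (0 : ℝ) r ×ˢ Metric.ball y₀ r := ⟨hs, hy⟩
    obtain ⟨hgs, hgU⟩ := hg _ hp
    have hDg : HasFDerivAt (fderiv ℝ g) (fderiv ℝ (fderiv ℝ g) (s, y)) (s, y) :=
      ((hgs.fderiv_right (m := ∞) (by simp)).differentiableAt (by simp)).hasFDerivAt
    have hsymm : IsSymmSndFDerivAt ℝ g (s, y) := hgs.isSymmSndFDerivAt (by
      rw [minSmoothness_of_isRCLikeNormedField]
      exact WithTop.coe_le_coe.2 le_top)
    have hJ : HasDerivAt (fun s => fderiv ℝ g (s, y) (0, w))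
        (fderiv ℝ (fderiv ℝ g) (s, y) (1, 0) (0, w)) s :=
      (hslice hDg).clm_apply (hasDerivAt_const s _) |>.congr_deriv (by simp)
    have hRd : HasFDerivAt R (fderiv ℝ R (g (s, y))) (g (s, y)) :=
      ((hR _ hgU).differentiableAt (by simp)).hasFDerivAt
    have had : HasFDerivAt a (fderiv ℝ a (g (s, y))) (g (s, y)) :=
      ((ha _ hgU).differentiableAt (by simp)).hasFDerivAt
    -- The variational equation, obtained by exchanging the time and space derivatives of `g`.
    have hJ' : fderiv ℝ (fderiv ℝ g) (s, y) (1, 0) (0, w) =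
        fderiv ℝ R (g (s, y)) (fderiv ℝ g (s, y) (0, w)) := by
      rw [hsymm (1, 0) (0, w)]
      have h1 : HasFDerivAt (fun p => fderiv ℝ g p (1, 0)) _ (s, y) :=
        hDg.clm_apply (hasFDerivAt_const ((1 : ℝ), (0 : E)) (s, y))
      have h2 : (fun p => fderiv ℝ g p (1, 0)) =ᶠ[𝓝 (s, y)] fun p => R (g p) := by
        filter_upwards [hopen.mem_nhds hp] with p hp' using htime p hp'
      have h3 := (h1.congr_of_eventuallyEq h2.symm).unique (hRd.comp (s, y) (hd _ hp))
      have h4 := congrArg (fun A : ℝ × E →L[ℝ] E => A (0, w)) h3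
      simpa using h4
    have h5 : HasDerivAt (fun s => a (g (s, y))) (fderiv ℝ a (g (s, y)) (R (g (s, y)))) s :=
      had.comp_hasDerivAt s ((hg' y hy).2 s hs)
    have h6 := h5.clm_apply hJ
    refine h6.congr_deriv ?_
    rw [hJ']
    have h7 : HasFDerivAt (fun z => a z (R z)) _ (g (s, y)) := had.clm_apply hRd
    have h8 : (fun z => a z (R z)) =ᶠ[𝓝 (g (s, y))] fun _ => 1 := by
      filter_upwards [hU.mem_nhds hgU] with z hz using haR z hz
    have h9 := (h7.congr_of_eventuallyEq h8.symm).unique (hasFDerivAt_const _ _)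
    have h10 := congrArg (fun A : E →L[ℝ] ℝ => A (fderiv ℝ g (s, y) (0, w))) h9
    have h11 := hdR _ hgU (fderiv ℝ g (s, y) (0, w))
    simp at h10 h11
    linarith
  have hp0 : ((0 : ℝ), y) ∈ Metric.ball (0 : ℝ) r ×ˢ Metric.ball y₀ r :=
    ⟨Metric.mem_ball_self (Metric.pos_of_mem_ball hs), hy⟩
  have hinit : fderiv ℝ g (0, y) (0, w) = w := by
    have h1 := (hd _ hp0).comp y (hasFDerivAt_prodMk_right (𝕜 := ℝ) (0 : ℝ) y)
    have h2 : (g ∘ fun z => ((0 : ℝ), z)) =ᶠ[𝓝 y] id := by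
      filter_upwards [Metric.isOpen_ball.mem_nhds hy] with z hz using (hg' z hz).1
    have h3 := (h1.congr_of_eventuallyEq h2.symm).unique (hasFDerivAt_id y)
    have h4 := congrArg (fun A : E →L[ℝ] E => A w) h3
    simpa using h4
  have hzero : a (g (s, y)) (fderiv ℝ g (s, y) (0, w)) = a y w := by
    have h1 := (convex_ball (0 : ℝ) r).is_const_of_fderivWithin_eq_zero (𝕜 := ℝ)
      (f := fun s => a (g (s, y)) (fderiv ℝ g (s, y) (0, w)))
      (fun s hs => (hconst s hs).differentiableAt.differentiableWithinAt)
      (fun s hs => by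
        rw [fderivWithin_of_isOpen Metric.isOpen_ball hs, (hconst s hs).hasFDerivAt.fderiv]
        ext
        simp) hs hp0.1
    rw [h1, hinit, (hg' y hy).1]
  have hsplit : ((σ, w) : ℝ × E) = σ • (1, 0) + (0, w) := by ext <;> simp
  rw [hsplit, map_add, map_smul, map_add, map_smul, htime _ ⟨hs, hy⟩, haR _ (hg _ ⟨hs, hy⟩).2,
    hzero, smul_eq_mul, mul_one]

/-- The term containing the second derivative of `τ` is symmetric and cancels on antisymmetrising.
-/
theorem dForm_eq_of_pullback {F : Type*} [NormedAddCommGroup F] [NormedSpace ℝ F]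
    {a : F → F →L[ℝ] ℝ} {b : E → E →L[ℝ] ℝ} {τ : E → F} {y : E} (ha : DifferentiableAt ℝ a (τ y))
    (hτ : ContDiffAt ℝ ∞ τ y) (hb : b =ᶠ[𝓝 y] fun z => (a (τ z)).comp (fderiv ℝ τ z)) (v w : E) :
    dForm b y v w = dForm a (τ y) (fderiv ℝ τ y v) (fderiv ℝ τ y w) := by
  have hsymm : IsSymmSndFDerivAt ℝ τ y := hτ.isSymmSndFDerivAt (by
    rw [minSmoothness_of_isRCLikeNormedField]
    exact WithTop.coe_le_coe.2 le_top)
  have h1 : HasFDerivAt (fderiv ℝ τ) (fderiv ℝ (fderiv ℝ τ) y) y :=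
    ((hτ.fderiv_right (m := ∞) (by simp)).differentiableAt (by simp)).hasFDerivAt
  have h2 : HasFDerivAt (fun z => a (τ z)) ((fderiv ℝ a (τ y)).comp (fderiv ℝ τ y)) y :=
    ha.hasFDerivAt.comp y (hτ.differentiableAt (by simp)).hasFDerivAt
  have h3 := ((h2.clm_comp h1).congr_of_eventuallyEq hb).fderiv
  have h4 := hsymm v w
  simp [dForm_apply, h3, h4]

theorem extDeriv_ofSubsingleton {a : E → E →L[ℝ] ℝ} {y : E} (ha : DifferentiableAt ℝ a y)
    (v w : E) :
    extDeriv (fun y => ContinuousAlternatingMap.ofSubsingleton ℝ E ℝ (0 : Fin 1) (a y)) y ![v, w] =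
      dForm a y v w := by
  have hL : IsBoundedLinearMap ℝ fun A : E →L[ℝ] ℝ =>
      ContinuousAlternatingMap.ofSubsingleton ℝ E ℝ (0 : Fin 1) A :=
    ⟨⟨fun _ _ => rfl, fun _ _ => rfl⟩, 1, one_pos, fun A => by
      rw [one_mul, ContinuousAlternatingMap.norm_ofSubsingleton]⟩
  have h1 : DifferentiableAt ℝ
      (fun y => ContinuousAlternatingMap.ofSubsingleton ℝ E ℝ (0 : Fin 1) (a y)) y :=
    hL.differentiableAt.comp y ha
  have h2 : ∀ u z : E, fderiv ℝ (fun y => a y u) y z = fderiv ℝ a y z u := by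
    intro u z
    rw [(ha.hasFDerivAt.clm_apply (hasFDerivAt_const u y)).fderiv]
    simp
  rw [extDeriv_apply h1, Fin.sum_univ_two]
  have h3 := h2 w v
  have h4 := h2 v w
  simp only [dForm_apply, ← h3, ← h4]
  simp [Fin.removeNth, sub_eq_add_neg]

end ReebVectorField

/-! ### Derivatives of charts and of their inverses. -/

section Charts

variable {E : Type*} [NormedAddCommGroup E] [NormedSpace ℝ E] {M : Type*} [TopologicalSpace M]
  [ChartedSpace E M] [IsManifold 𝓘(ℝ, E) ∞ M] {x₀ : M}

theorem contMDiffAt_extChartAt_symm_of_mem {y : E} (hy : y ∈ (extChartAt 𝓘(ℝ, E) x₀).target) :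
    ContMDiffAt 𝓘(ℝ, E) 𝓘(ℝ, E) ∞ (extChartAt 𝓘(ℝ, E) x₀).symm y :=
  (contMDiffOn_extChartAt_symm x₀).contMDiffAt ((isOpen_extChartAt_target x₀).mem_nhds hy)

theorem contMDiffAt_extChartAt_of_mem {x : M} (hx : x ∈ (extChartAt 𝓘(ℝ, E) x₀).source) :
    ContMDiffAt 𝓘(ℝ, E) 𝓘(ℝ, E) ∞ (extChartAt 𝓘(ℝ, E) x₀) x :=
  contMDiffAt_extChartAt' (by simpa using hx)

/-- The derivative at `x` of the chart at `x₀`. -/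
def chartDeriv (x₀ x : M) : TangentSpace 𝓘(ℝ, E) x →L[ℝ] E :=
  mfderiv 𝓘(ℝ, E) 𝓘(ℝ, E) (extChartAt 𝓘(ℝ, E) x₀) x

/-- The derivative at `y` of the inverse of the chart at `x₀`. -/
def chartDerivSymm (x₀ : M) (y : E) :
    E →L[ℝ] TangentSpace 𝓘(ℝ, E) ((extChartAt 𝓘(ℝ, E) x₀).symm y) :=
  mfderiv 𝓘(ℝ, E) 𝓘(ℝ, E) (extChartAt 𝓘(ℝ, E) x₀).symm y

theorem chartDeriv_chartDerivSymm {y : E} (hy : y ∈ (extChartAt 𝓘(ℝ, E) x₀).target) (w : E) :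
    chartDeriv x₀ ((extChartAt 𝓘(ℝ, E) x₀).symm y) (chartDerivSymm x₀ y w) = w := by
  have : IsManifold 𝓘(ℝ, E) 1 M := IsManifold.of_le (n := ∞) (by simp)
  have h := mfderiv_extChartAt_comp_mfderivWithin_extChartAt_symm (I := 𝓘(ℝ, E)) hy
  rw [ModelWithCorners.range_eq_univ, mfderivWithin_univ] at h
  exact congrArg (fun A : E →L[ℝ] E => A w) h

theorem chartDerivSymm_chartDeriv {y : E} (hy : y ∈ (extChartAt 𝓘(ℝ, E) x₀).target)
    (v : TangentSpace 𝓘(ℝ, E) ((extChartAt 𝓘(ℝ, E) x₀).symm y)) :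
    chartDerivSymm x₀ y (chartDeriv x₀ ((extChartAt 𝓘(ℝ, E) x₀).symm y) v) = v := by
  have : IsManifold 𝓘(ℝ, E) 1 M := IsManifold.of_le (n := ∞) (by simp)
  have h := mfderivWithin_extChartAt_symm_comp_mfderiv_extChartAt (I := 𝓘(ℝ, E)) hy
  rw [ModelWithCorners.range_eq_univ, mfderivWithin_univ] at h
  exact congrArg (fun A : E →L[ℝ] E => A v) h

theorem chartDeriv_surjective {x : M} (hx : x ∈ (extChartAt 𝓘(ℝ, E) x₀).source) :
    Function.Surjective (chartDeriv (E := E) x₀ x) := by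
  have : IsManifold 𝓘(ℝ, E) 1 M := IsManifold.of_le (n := ∞) (by simp)
  exact (isInvertible_mfderiv_extChartAt hx).bijective.2

theorem chartDeriv_self (x : M) (v : TangentSpace 𝓘(ℝ, E) x) : chartDeriv x x v = v := by
  have : IsManifold 𝓘(ℝ, E) 1 M := IsManifold.of_le (n := ∞) (by simp)
  exact congrArg (fun A : E →L[ℝ] E => A v) (mfderiv_extChartAt_self (I := 𝓘(ℝ, E)) (x := x))

theorem trivializationAt_tangent_apply {x : M} (hx : x ∈ (extChartAt 𝓘(ℝ, E) x₀).source)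
    (v : TangentSpace 𝓘(ℝ, E) x) :
    letI : IsManifold 𝓘(ℝ, E) 1 M := IsManifold.of_le (n := ∞) (by simp)
    (trivializationAt E (TangentSpace 𝓘(ℝ, E) (M := M)) x₀ ⟨x, v⟩).2 = chartDeriv x₀ x v := by
  have : IsManifold 𝓘(ℝ, E) 1 M := IsManifold.of_le (n := ∞) (by simp)
  have hx' : x ∈ (chartAt E x₀).source := by simpa using hx
  have h := TangentBundle.continuousLinearMapAt_trivializationAt (I := 𝓘(ℝ, E)) hx'
  have h1 := congrArg (fun A : E →L[ℝ] E => A v) h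
  refine Eq.trans ?_ h1
  have hb : x ∈ (trivializationAt E (TangentSpace 𝓘(ℝ, E) (M := M)) x₀).baseSet := by
    simpa using hx'
  have h2 := Bundle.Trivialization.coe_linearMapAt_of_mem (R := ℝ)
    (trivializationAt E (TangentSpace 𝓘(ℝ, E) (M := M)) x₀) hb
  exact (congrFun h2 v).symm

end Charts

/-! ### Contact forms in charts and the global Reeb field. -/

section ContactCharts

variable {n : ℕ} {M : Type*} [TopologicalSpace M]
  [ChartedSpace (EuclideanSpace ℝ (Fin (2 * n + 1))) M] [IsManifold (𝓡 (2 * n + 1)) ∞ M]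

theorem localForm_apply (α : ContactForm n M) (x₀ : M)
    (y w : EuclideanSpace ℝ (Fin (2 * n + 1))) : localForm α.form x₀ y w =
      α.form ((extChartAt (𝓡 (2 * n + 1)) x₀).symm y) (chartDerivSymm x₀ y w) := rfl

theorem form_eq_localForm (α : ContactForm n M) {x₀ x : M}
    (hx : x ∈ (extChartAt (𝓡 (2 * n + 1)) x₀).source) (v : TangentSpace (𝓡 (2 * n + 1)) x) :
    α.form x v = localForm α.form x₀ (extChartAt (𝓡 (2 * n + 1)) x₀ x) (chartDeriv x₀ x v) := by
  obtain ⟨y, hy, rfl⟩ : ∃ y ∈ (extChartAt (𝓡 (2 * n + 1)) x₀).target,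
      (extChartAt (𝓡 (2 * n + 1)) x₀).symm y = x :=
    ⟨_, (extChartAt (𝓡 (2 * n + 1)) x₀).map_source hx, (extChartAt (𝓡 (2 * n + 1)) x₀).left_inv hx⟩
  rw [(extChartAt (𝓡 (2 * n + 1)) x₀).right_inv hy, localForm_apply, chartDerivSymm_chartDeriv hy]

theorem contDiffAt_localForm (α : ContactForm n M) {x₀ : M}
    {y : EuclideanSpace ℝ (Fin (2 * n + 1))} (hy : y ∈ (extChartAt (𝓡 (2 * n + 1)) x₀).target) :
    ContDiffAt ℝ ∞ (localForm α.form x₀) y := by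
  have : IsManifold (𝓡 (2 * n + 1)) 1 M := IsManifold.of_le (n := ∞) (by simp)
  set e := trivializationAt (EuclideanSpace ℝ (Fin (2 * n + 1)) →L[ℝ] ℝ)
    (fun x : M => TangentSpace (𝓡 (2 * n + 1)) x →L[ℝ] Bundle.Trivial M ℝ x) x₀ with he
  have hsrc : ∀ z ∈ (extChartAt (𝓡 (2 * n + 1)) x₀).target,
      (extChartAt (𝓡 (2 * n + 1)) x₀).symm z ∈ (chartAt (EuclideanSpace ℝ (Fin (2 * n + 1))) x₀).source :=
    fun z hz => by simpa using (extChartAt (𝓡 (2 * n + 1)) x₀).map_target hz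
  have hmem : (extChartAt (𝓡 (2 * n + 1)) x₀).symm y ∈ e.baseSet := by
    rw [he, hom_trivializationAt_baseSet]
    exact ⟨by simpa using hsrc y hy, by simp⟩
  have h1 := (e.contMDiffAt_section_iff hmem).1 (α.smooth ((extChartAt (𝓡 (2 * n + 1)) x₀).symm y))
  have h2 := h1.comp y (contMDiffAt_extChartAt_symm_of_mem hy)
  refine h2.contDiffAt.congr_of_eventuallyEq ?_
  filter_upwards [(isOpen_extChartAt_target x₀).mem_nhds hy] with z hz
  have h3 := TangentBundle.symmL_trivializationAt (I := 𝓡 (2 * n + 1)) (hsrc z hz)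
  rw [ModelWithCorners.range_eq_univ, mfderivWithin_univ] at h3
  rw [(extChartAt (𝓡 (2 * n + 1)) x₀).right_inv hz] at h3
  simp only [Function.comp_def, he, hom_trivializationAt_apply]
  ext w
  have h4 := congrArg (fun A : EuclideanSpace ℝ (Fin (2 * n + 1)) →L[ℝ]
    EuclideanSpace ℝ (Fin (2 * n + 1)) => A w) h3.symm
  refine (congrArg (α.form ((extChartAt (𝓡 (2 * n + 1)) x₀).symm z)) h4).trans ?_
  simp [ContinuousLinearMap.inCoordinates]
  rfl

/-- `exteriorDeriv` uses a chart that varies with the point, whereas smoothness arguments need one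
fixed chart. The two expressions of `α` differ by pullback along the transition map, which commutes
with `d`. -/
theorem dForm_localForm_chart_change (α : ContactForm n M) {x₀ x₁ x : M}
    (hx₀ : x ∈ (extChartAt (𝓡 (2 * n + 1)) x₀).source)
    (hx₁ : x ∈ (extChartAt (𝓡 (2 * n + 1)) x₁).source) (v w : TangentSpace (𝓡 (2 * n + 1)) x) :
    dForm (localForm α.form x₁) (extChartAt (𝓡 (2 * n + 1)) x₁ x)
      (chartDeriv x₁ x v) (chartDeriv x₁ x w) =
    dForm (localForm α.form x₀) (extChartAt (𝓡 (2 * n + 1)) x₀ x)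
      (chartDeriv x₀ x v) (chartDeriv x₀ x w) := by
  obtain ⟨y, hy, rfl⟩ : ∃ y ∈ (extChartAt (𝓡 (2 * n + 1)) x₁).target,
      (extChartAt (𝓡 (2 * n + 1)) x₁).symm y = x :=
    ⟨_, (extChartAt (𝓡 (2 * n + 1)) x₁).map_source hx₁,
      (extChartAt (𝓡 (2 * n + 1)) x₁).left_inv hx₁⟩
  rw [(extChartAt (𝓡 (2 * n + 1)) x₁).right_inv hy]
  set τ := extChartAt (𝓡 (2 * n + 1)) x₀ ∘ (extChartAt (𝓡 (2 * n + 1)) x₁).symm with hτ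
  have hsymm : ∀ z ∈ (extChartAt (𝓡 (2 * n + 1)) x₁).target,
      ContMDiffAt 𝓘(ℝ, EuclideanSpace ℝ (Fin (2 * n + 1))) (𝓡 (2 * n + 1)) ∞
      (extChartAt (𝓡 (2 * n + 1)) x₁).symm z := fun z hz => contMDiffAt_extChartAt_symm_of_mem hz
  have hτs : ContDiffAt ℝ ∞ τ y :=
    ((contMDiffAt_extChartAt_of_mem hx₀).comp y (hsymm y hy)).contDiffAt
  have hτd : ∀ z ∈ (extChartAt (𝓡 (2 * n + 1)) x₁).target,
      (extChartAt (𝓡 (2 * n + 1)) x₁).symm z ∈ (extChartAt (𝓡 (2 * n + 1)) x₀).source →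
      ∀ u, fderiv ℝ τ z u = chartDeriv x₀ ((extChartAt (𝓡 (2 * n + 1)) x₁).symm z)
        (chartDerivSymm x₁ z u) := by
    intro z hz hz' u
    rw [← mfderiv_eq_fderiv, hτ, mfderiv_comp z
      ((contMDiffAt_extChartAt_of_mem hz').mdifferentiableAt (by simp))
      ((hsymm z hz).mdifferentiableAt (by simp))]
    rfl
  have hb : localForm α.form x₁ =ᶠ[𝓝 y]
      fun z => (localForm α.form x₀ (τ z)).comp (fderiv ℝ τ z) := by
    filter_upwards [(isOpen_extChartAt_target x₁).mem_nhds hy,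
      (hsymm y hy).continuousAt.preimage_mem_nhds
        ((isOpen_extChartAt_source (I := 𝓡 (2 * n + 1)) x₀).mem_nhds hx₀)] with z hz hz'
    ext u
    rw [ContinuousLinearMap.comp_apply, hτd z hz hz' u]
    exact form_eq_localForm α hz' _
  have key := dForm_eq_of_pullback (a := localForm α.form x₀) (τ := τ) (y := y)
    ((contDiffAt_localForm α ((extChartAt (𝓡 (2 * n + 1)) x₀).map_source hx₀)).differentiableAt
      (by simp)) hτs hb
    (chartDeriv x₁ ((extChartAt (𝓡 (2 * n + 1)) x₁).symm y) v)
    (chartDeriv x₁ ((extChartAt (𝓡 (2 * n + 1)) x₁).symm y) w)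
  rw [hτd y hy hx₀, hτd y hy hx₀, chartDerivSymm_chartDeriv hy,
    chartDerivSymm_chartDeriv hy] at key
  exact key

theorem exteriorDeriv_eq_dForm_localForm (α : ContactForm n M) {x₀ x : M}
    (hx₀ : x ∈ (extChartAt (𝓡 (2 * n + 1)) x₀).source) (v w : TangentSpace (𝓡 (2 * n + 1)) x) :
    exteriorDeriv α.form x v w =
    dForm (localForm α.form x₀) (extChartAt (𝓡 (2 * n + 1)) x₀ x)
      (chartDeriv x₀ x v) (chartDeriv x₀ x w) := by
  rw [← dForm_localForm_chart_change α hx₀ (mem_extChartAt_source x)]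
  exact extDeriv_ofSubsingleton ((contDiffAt_localForm α (mem_extChartAt_target x)).differentiableAt
    (by simp)) _ _

theorem isContactAt_localForm (α : ContactForm n M) {x₀ : M}
    {y : EuclideanSpace ℝ (Fin (2 * n + 1))} (hy : y ∈ (extChartAt (𝓡 (2 * n + 1)) x₀).target) :
    IsContactAt (localForm α.form x₀) y := by
  have hxs : (extChartAt (𝓡 (2 * n + 1)) x₀).symm y ∈ (extChartAt (𝓡 (2 * n + 1)) x₀).source :=
    (extChartAt (𝓡 (2 * n + 1)) x₀).map_target hy
  have hxy := (extChartAt (𝓡 (2 * n + 1)) x₀).right_inv hy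
  refine ⟨fun h0 => α.ne_zero ((extChartAt (𝓡 (2 * n + 1)) x₀).symm y) ?_, fun v hv hv' => ?_⟩
  · ext v
    rw [form_eq_localForm α hxs, hxy, h0]
    rfl
  · have hV0 : chartDerivSymm x₀ y v = 0 := by
      refine α.nondegenerate _ _ hv fun W hW => ?_
      rw [exteriorDeriv_eq_dForm_localForm α hxs, hxy, chartDeriv_chartDerivSymm hy]
      refine hv' _ ?_
      rwa [form_eq_localForm α hxs, hxy] at hW
    rw [← chartDeriv_chartDerivSymm hy v, hV0, map_zero]

/-- The Reeb vector field of a contact form. -/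
def reeb (α : ContactForm n M) (x : M) : TangentSpace (𝓡 (2 * n + 1)) x :=
  (localReeb (localForm α.form x) (extChartAt (𝓡 (2 * n + 1)) x x) :
    EuclideanSpace ℝ (Fin (2 * n + 1)))

theorem chartDeriv_self_reeb (α : ContactForm n M) (x : M) :
    chartDeriv x x (reeb α x) = localReeb (localForm α.form x) (extChartAt (𝓡 (2 * n + 1)) x x) :=
  chartDeriv_self x (reeb α x)

/-- The conditions `α(R) = 1` and `i_R dα = 0` are independent of the chart and determine `R`, so
the pointwise definition of `reeb` is represented by one smooth formula throughout a chart. -/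
theorem chartDeriv_reeb (α : ContactForm n M) {x₀ x : M}
    (hx : x ∈ (extChartAt (𝓡 (2 * n + 1)) x₀).source) :
    chartDeriv x₀ x (reeb α x) =
      localReeb (localForm α.form x₀) (extChartAt (𝓡 (2 * n + 1)) x₀ x) := by
  have hy := (extChartAt (𝓡 (2 * n + 1)) x₀).map_source hx
  have hc := isContactAt_localForm α (mem_extChartAt_target (I := 𝓡 (2 * n + 1)) x)
  apply (isContactAt_localForm α hy).eq_localReeb
  · rw [← form_eq_localForm α hx, form_eq_localForm α (mem_extChartAt_source x),
      chartDeriv_self_reeb, hc.apply_localReeb]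
  · intro w
    obtain ⟨W, rfl⟩ := chartDeriv_surjective hx w
    rw [← dForm_localForm_chart_change α hx (mem_extChartAt_source x), chartDeriv_self_reeb,
      hc.dForm_localReeb]

theorem contMDiff_reeb (α : ContactForm n M) :
    letI : IsManifold (𝓡 (2 * n + 1)) 1 M := IsManifold.of_le (n := ∞) (by simp)
    ContMDiff (𝓡 (2 * n + 1)) (𝓡 (2 * n + 1)).tangent 1
      (fun x => (⟨x, reeb α x⟩ : TangentBundle (𝓡 (2 * n + 1)) M)) := by
  have : IsManifold (𝓡 (2 * n + 1)) 1 M := IsManifold.of_le (n := ∞) (by simp)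
  have : IsManifold (𝓡 (2 * n + 1)) (1 + 1) M := IsManifold.of_le (n := ∞) (by
    exact WithTop.coe_le_coe.2 le_top)
  intro x₀
  refine (Bundle.contMDiffAt_section x₀).2 ?_
  have h1 : ContMDiffAt (𝓡 (2 * n + 1)) 𝓘(ℝ, EuclideanSpace ℝ (Fin (2 * n + 1))) ∞
      (fun x => localReeb (localForm α.form x₀) (extChartAt (𝓡 (2 * n + 1)) x₀ x)) x₀ :=
    ((isContactAt_localForm α (mem_extChartAt_target x₀)).contDiffAt_localReeb
      (contDiffAt_localForm α (mem_extChartAt_target x₀))).contMDiffAt.comp x₀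
      (contMDiffAt_extChartAt_of_mem (mem_extChartAt_source x₀))
  refine (h1.of_le (by simp)).congr_of_eventuallyEq ?_
  filter_upwards [(isOpen_extChartAt_source (I := 𝓡 (2 * n + 1)) x₀).mem_nhds
    (mem_extChartAt_source x₀)] with x hx
  rw [← chartDeriv_reeb α hx]
  exact trivializationAt_tangent_apply hx _

end ContactCharts

theorem hasMFDerivAt_of_hasFDerivAt_prod {E F : Type*} [NormedAddCommGroup E] [NormedSpace ℝ E]
    [NormedAddCommGroup F] [NormedSpace ℝ F] {g : ℝ × E → F} {g' : ℝ × E →L[ℝ] F} {p : ℝ × E}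
    (h : HasFDerivAt g g' p) :
    HasMFDerivAt (𝓘(ℝ, ℝ).prod 𝓘(ℝ, E)) 𝓘(ℝ, F) g p g' := by
  have h1 : HasMFDerivAt 𝓘(ℝ, ℝ × E) 𝓘(ℝ, F) g p g' := h.hasMFDerivAt
  rw [modelWithCornersSelf_prod, ← chartedSpaceSelf_prod] at h1
  exact h1

theorem contMDiffAt_of_contDiffAt_prod {E F : Type*} [NormedAddCommGroup E] [NormedSpace ℝ E]
    [NormedAddCommGroup F] [NormedSpace ℝ F] {g : ℝ × E → F} {p : ℝ × E}
    (h : ContDiffAt ℝ ∞ g p) :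
    ContMDiffAt (𝓘(ℝ, ℝ).prod 𝓘(ℝ, E)) 𝓘(ℝ, F) ∞ g p := by
  have h1 : ContMDiffAt 𝓘(ℝ, ℝ × E) 𝓘(ℝ, F) ∞ g p := h.contMDiffAt
  rw [modelWithCornersSelf_prod, ← chartedSpaceSelf_prod] at h1
  exact h1

/-! ### The Reeb flow on the manifold. -/

section LocalFlow

variable {n : ℕ} {M : Type*} [TopologicalSpace M]
  [ChartedSpace (EuclideanSpace ℝ (Fin (2 * n + 1))) M] [IsManifold (𝓡 (2 * n + 1)) ∞ M]

/-- The infinitesimal equation of a Reeb flow `h` at the point `q`. -/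
def IsReebDeriv (α : ContactForm n M) (h : ℝ × M → M) (q : ℝ × M) : Prop :=
  ∀ (σ : ℝ) (v : TangentSpace (𝓡 (2 * n + 1)) q.2),
    α.form (h q) (mfderiv (𝓘(ℝ, ℝ).prod (𝓡 (2 * n + 1))) (𝓡 (2 * n + 1)) h q (σ, v)) =
      σ + α.form q.2 v

theorem form_congr (α : ContactForm n M) {x y : M} (h : x = y)
    (v : EuclideanSpace ℝ (Fin (2 * n + 1))) :
    α.form x (v : TangentSpace (𝓡 (2 * n + 1)) x) = α.form y (v : TangentSpace (𝓡 (2 * n + 1)) y) := by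
  subst h
  rfl

theorem IsReebDeriv.congr {α : ContactForm n M} {h k : ℝ × M → M} {q : ℝ × M}
    (hk : IsReebDeriv α k q) (hev : h =ᶠ[𝓝 q] k) : IsReebDeriv α h q := by
  intro σ v
  rw [hev.mfderiv_eq]
  exact (form_congr α hev.eq_of_nhds _).trans (hk σ v)

/-- The flow is built in the chart at `x₀` and carried back to `M`, together with the identity from
`flow_preserves_form`. -/
theorem exists_local_reeb_flow (α : ContactForm n M) (x₀ : M) :
    ∃ r > 0, ∃ U : Set M, IsOpen U ∧ x₀ ∈ U ∧ ∃ h : ℝ × M → M,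
      (∀ q ∈ Metric.ball (0 : ℝ) r ×ˢ U,
        ContMDiffAt (𝓘(ℝ, ℝ).prod (𝓡 (2 * n + 1))) (𝓡 (2 * n + 1)) ∞ h q ∧ IsReebDeriv α h q) ∧
      ∀ x ∈ U, h (0, x) = x ∧ IsMIntegralCurveOn (fun s => h (s, x)) (reeb α) (Ioo (-r) r) := by
  set φ := extChartAt (𝓡 (2 * n + 1)) x₀ with hφ
  have htarget : IsOpen φ.target := isOpen_extChartAt_target x₀
  obtain ⟨r, hr, g, hg, hg'⟩ := exists_smooth_local_flow (f := localReeb (localForm α.form x₀))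
    (htarget.mem_nhds (mem_extChartAt_target x₀))
    (fun y hy => (isContactAt_localForm α hy).contDiffAt_localReeb (contDiffAt_localForm α hy))
  have hform := fun {s} (hs : s ∈ Metric.ball (0 : ℝ) r) {y} (hy : y ∈ Metric.ball _ r) =>
    flow_preserves_form (a := localForm α.form x₀) htarget (fun y hy => contDiffAt_localForm α hy)
    (fun y hy => (isContactAt_localForm α hy).contDiffAt_localReeb (contDiffAt_localForm α hy))
    (fun y hy => (isContactAt_localForm α hy).apply_localReeb)
    (fun y hy => (isContactAt_localForm α hy).dForm_localReeb) hg hg' hs hy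
  set U := φ.source ∩ φ ⁻¹' Metric.ball (φ x₀) r with hU
  have hUo : IsOpen U := (continuousOn_extChartAt x₀).isOpen_inter_preimage
    (isOpen_extChartAt_source x₀) Metric.isOpen_ball
  refine ⟨r, hr, U, hUo, ⟨mem_extChartAt_source x₀, Metric.mem_ball_self hr⟩,
    fun q => φ.symm (g (q.1, φ q.2)), ?_, ?_⟩
  · rintro ⟨s, x⟩ ⟨hs, hxs, hxb⟩
    have hp : ((s, φ x) : ℝ × _) ∈ Metric.ball (0 : ℝ) r ×ˢ Metric.ball (φ x₀) r := ⟨hs, hxb⟩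
    obtain ⟨hgs, hgt⟩ := hg _ hp
    have hk : ContMDiffAt (𝓘(ℝ, ℝ).prod (𝓡 (2 * n + 1)))
        (𝓘(ℝ, ℝ).prod 𝓘(ℝ, EuclideanSpace ℝ (Fin (2 * n + 1)))) ∞
        (fun q : ℝ × M => (q.1, φ q.2)) (s, x) :=
      contMDiffAt_fst.prodMk ((contMDiffAt_extChartAt_of_mem hxs).comp (s, x) contMDiffAt_snd)
    have hgk := (contMDiffAt_of_contDiffAt_prod hgs).comp (s, x) hk
    refine ⟨(contMDiffAt_extChartAt_symm_of_mem hgt).comp (s, x) hgk, fun σ v => ?_⟩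
    have h1 : HasMFDerivAt (𝓘(ℝ, ℝ).prod (𝓡 (2 * n + 1)))
        𝓘(ℝ, EuclideanSpace ℝ (Fin (2 * n + 1))) (fun q : ℝ × M => φ q.2) (s, x)
        ((chartDeriv x₀ x).comp (ContinuousLinearMap.snd ℝ _ _)) :=
      ((contMDiffAt_extChartAt_of_mem hxs).mdifferentiableAt (by simp)).hasMFDerivAt.comp (s, x)
        (hasMFDerivAt_snd (s, x))
    have h2 := (hasMFDerivAt_fst (I := 𝓘(ℝ, ℝ)) (I' := 𝓡 (2 * n + 1)) (s, x)).prodMk h1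
    have h3 := (hasMFDerivAt_of_hasFDerivAt_prod
      (hgs.differentiableAt (by simp)).hasFDerivAt).comp (s, x) h2
    have h4 := (((contMDiffAt_extChartAt_symm_of_mem hgt).mdifferentiableAt
      (by simp)).hasMFDerivAt).comp (s, x) h3
    have h5 : mfderiv (𝓘(ℝ, ℝ).prod (𝓡 (2 * n + 1))) (𝓡 (2 * n + 1))
        (fun q : ℝ × M => φ.symm (g (q.1, φ q.2))) (s, x) (σ, v) =
        chartDerivSymm x₀ (g (s, φ x)) (fderiv ℝ g (s, φ x) (σ, chartDeriv x₀ x v)) :=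
      congrArg (fun A : ℝ × EuclideanSpace ℝ (Fin (2 * n + 1)) →L[ℝ]
        EuclideanSpace ℝ (Fin (2 * n + 1)) => A (σ, v)) h4.mfderiv
    rw [h5]
    refine (localForm_apply α x₀ _ _).symm.trans ?_
    rw [hform hs hxb, form_eq_localForm α hxs]
  · rintro x ⟨hxs, hxb⟩
    obtain ⟨h0, hd⟩ := hg' (φ x) hxb
    refine ⟨?_, fun s hs => ?_⟩
    · simp only [h0]
      exact φ.left_inv hxs
    · have hs' : s ∈ Metric.ball (0 : ℝ) r := by rwa [Real.ball_zero_eq_Ioo]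
      have hgt := (hg (s, φ x) ⟨hs', hxb⟩).2
      have h1 := (((contMDiffAt_extChartAt_symm_of_mem hgt).mdifferentiableAt
        (by simp)).hasMFDerivAt).comp s (hd s hs').hasFDerivAt.hasMFDerivAt
      refine (h1.congr_mfderiv ?_).hasMFDerivWithinAt
      have h2 : chartDerivSymm x₀ (g (s, φ x)) (localReeb (localForm α.form x₀) (g (s, φ x))) =
          reeb α (φ.symm (g (s, φ x))) := by
        have h3 := chartDeriv_reeb α (x₀ := x₀) (φ.map_target hgt)
        rw [φ.right_inv hgt] at h3
        rw [← h3, chartDerivSymm_chartDeriv hgt]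
      refine ContinuousLinearMap.ext fun (u : ℝ) => ?_
      have h4 : chartDerivSymm x₀ (g (s, φ x)) (u • localReeb (localForm α.form x₀) (g (s, φ x))) =
          u • reeb α (φ.symm (g (s, φ x))) := by
        rw [map_smul, h2]
      exact h4

/-- For short times the Reeb flow exists, is smooth, and its time maps are injective. -/
theorem exists_reeb_flow [T2Space M] [CompactSpace M] (α : ContactForm n M) :
    ∃ ε > 0, ∃ ρ : ℝ × M → M, (∀ x, ρ (0, x) = x) ∧
      (∀ s ∈ Metric.ball (0 : ℝ) ε, ∀ x,
        ContMDiffAt (𝓘(ℝ, ℝ).prod (𝓡 (2 * n + 1))) (𝓡 (2 * n + 1)) ∞ ρ (s, x) ∧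
        IsReebDeriv α ρ (s, x)) ∧
      ∀ s x, ρ (-s, ρ (s, x)) = x := by
  have : IsManifold (𝓡 (2 * n + 1)) 1 M := IsManifold.of_le (n := ∞) (by simp)
  choose r hr U hU hxU h hh hh' using exists_local_reeb_flow α
  obtain ⟨t, ht⟩ := CompactSpace.elim_nhds_subcover U fun x => (hU x).mem_nhds (hxU x)
  obtain ⟨ε, hεr, hε⟩ : ∃ ε, (∀ i ∈ t, ε ∈ Ioc 0 (r i)) ∧ ε ∈ Ioi (0 : ℝ) :=
    (((Filter.eventually_all_finset (l := 𝓝[>] (0 : ℝ)) t).2 fun i _ =>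
      Ioc_mem_nhdsGT (hr i)).and self_mem_nhdsWithin).exists
  have hε0 : 0 < ε := hε
  have hcov : ∀ x, ∃ i ∈ t, x ∈ U i := by
    intro x
    have hx : x ∈ ⋃ i ∈ t, U i := by
      rw [ht]
      trivial
    simpa using hx
  have hcurve : ∀ i ∈ t, ∀ x ∈ U i,
      IsMIntegralCurveOn (fun s => h i (s, x)) (reeb α) (Ioo (-ε) ε) := fun i hi x hx =>
    ((hh' i x hx).2).mono (Ioo_subset_Ioo (neg_le_neg (hεr i hi).2) (hεr i hi).2)
  -- A lifetime `ε` common to all starting points makes every integral curve extend to `ℝ`. Below,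
  -- uniqueness identifies these curves with the smooth local flows for short times and gives the
  -- group law.
  have hglobal : ∀ x : M, ∃ γ : ℝ → M, γ 0 = x ∧ IsMIntegralCurve γ (reeb α) := by
    refine exists_isMIntegralCurve_of_isMIntegralCurveOn (contMDiff_reeb α) hε0 fun x => ?_
    obtain ⟨i, hi, hx⟩ := hcov x
    exact ⟨_, (hh' i x hx).1, hcurve i hi x hx⟩
  choose γ hγ0 hγ using hglobal
  have hagree : ∀ i ∈ t, ∀ x ∈ U i, ∀ s ∈ Metric.ball (0 : ℝ) ε, γ x s = h i (s, x) := by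
    intro i hi x hx s hs
    rw [Real.ball_zero_eq_Ioo] at hs
    exact isMIntegralCurveOn_Ioo_eqOn_of_contMDiff_boundaryless (t₀ := 0)
      ⟨neg_lt_zero.2 hε0, hε0⟩ (contMDiff_reeb α) ((hγ x).isMIntegralCurveOn _)
      (hcurve i hi x hx) ((hγ0 x).trans (hh' i x hx).1.symm) hs
  refine ⟨ε, hε0, fun q => γ q.2 q.1, hγ0, fun s hs x => ?_, fun s x => ?_⟩
  · obtain ⟨i, hi, hx⟩ := hcov x
    have hev : (fun q : ℝ × M => γ q.2 q.1) =ᶠ[𝓝 (s, x)] h i := by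
      filter_upwards [(Metric.isOpen_ball.prod (hU i)).mem_nhds (show (s, x) ∈ _ ×ˢ _ from ⟨hs, hx⟩)]
        with q hq using hagree i hi q.2 hq.2 q.1 hq.1
    obtain ⟨h1, h2⟩ := hh i (s, x) ⟨Metric.ball_subset_ball (hεr i hi).2 hs, hx⟩
    exact ⟨h1.congr_of_eventuallyEq hev, h2.congr hev⟩
  · have h1 : IsMIntegralCurve (fun u => γ x (u + s)) (reeb α) := (hγ x).comp_add s
    have h2 := isMIntegralCurve_Ioo_eq_of_contMDiff_boundaryless (t₀ := 0) (contMDiff_reeb α)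
      (hγ (γ x s)) h1 (by simp [hγ0])
    have h3 := congrFun h2 (-s)
    simpa [hγ0] using h3

/-- A family of maps, smooth for all times, which for short times is the Reeb flow. -/
theorem exists_smooth_reeb_family [T2Space M] [CompactSpace M] (α : ContactForm n M) :
    ∃ ε > 0, ∃ ρ : ℝ × M → M,
      ContMDiff (𝓘(ℝ, ℝ).prod (𝓡 (2 * n + 1))) (𝓡 (2 * n + 1)) ∞ ρ ∧ (∀ x, ρ (0, x) = x) ∧
      ∀ s ∈ Metric.ball (0 : ℝ) ε,
        (Function.Injective fun x => ρ (s, x)) ∧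
        (∀ x, Function.Injective
          (mfderiv (𝓡 (2 * n + 1)) (𝓡 (2 * n + 1)) (fun x => ρ (s, x)) x)) ∧
        ∀ x, IsReebDeriv α ρ (s, x) := by
  obtain ⟨ε, hε, ρ, h0, hρ, hinv⟩ := exists_reeb_flow α
  -- Time `s` is replaced by `s * b s`, which always stays in the range where `ρ` is known to be
  -- smooth and equals `s` for `|s| < ε / 3`.
  let b : ContDiffBump (0 : ℝ) := ⟨ε / 3, ε / 2, by positivity, by linarith⟩
  have hbε : ∀ s : ℝ, s * b s ∈ Metric.ball (0 : ℝ) ε := by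
    intro s
    by_cases hs : s ∈ Metric.ball (0 : ℝ) (ε / 2)
    · rw [mem_ball_zero_iff, Real.norm_eq_abs] at hs ⊢
      rw [abs_mul, abs_of_nonneg b.nonneg]
      exact (mul_le_of_le_one_right (abs_nonneg s) b.le_one).trans_lt (by linarith)
    · have h1 : b s = 0 := by
        rw [← Function.notMem_support, b.support_eq]
        exact hs
      rw [h1, mul_zero]
      exact Metric.mem_ball_self hε
  have hb1 : ∀ s ∈ Metric.ball (0 : ℝ) (ε / 3), s * b s = s := by
    intro s hs
    rw [b.one_of_mem_closedBall (Metric.ball_subset_closedBall hs), mul_one]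
  have hbs : ContDiff ℝ ∞ fun s : ℝ => s * b s := contDiff_id.mul b.contDiff
  have hsub : Metric.ball (0 : ℝ) (ε / 3) ⊆ Metric.ball 0 ε :=
    Metric.ball_subset_ball (by linarith)
  refine ⟨ε / 3, by positivity, fun q => ρ (q.1 * b q.1, q.2), ?_, ?_, fun s hs => ⟨?_, ?_, ?_⟩⟩
  · intro q
    have h1 : ContMDiffAt (𝓘(ℝ, ℝ).prod (𝓡 (2 * n + 1))) (𝓘(ℝ, ℝ).prod (𝓡 (2 * n + 1))) ∞
        (fun q : ℝ × M => (q.1 * b q.1, q.2)) q :=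
      (hbs.contMDiff.contMDiffAt.comp q contMDiffAt_fst).prodMk contMDiffAt_snd
    exact (hρ _ (hbε q.1) q.2).1.comp q h1
  · intro x
    simp [h0]
  · intro x y hxy
    simp only [hb1 s hs] at hxy
    rw [← hinv s x, hxy, hinv]
  · intro x
    have hfun : (fun x => ρ (s * b s, x)) = fun x => ρ (s, x) := by rw [hb1 s hs]
    change Function.Injective
      (mfderiv (𝓡 (2 * n + 1)) (𝓡 (2 * n + 1)) (fun x => ρ (s * b s, x)) x)
    rw [hfun]
    have hd : ∀ u ∈ Metric.ball (0 : ℝ) ε, ∀ z, MDifferentiableAt (𝓡 (2 * n + 1))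
        (𝓡 (2 * n + 1)) (fun x => ρ (u, x)) z := fun u hu z =>
      ((hρ u hu z).1.mdifferentiableAt (by simp)).comp z
        (mdifferentiableAt_const.prodMk mdifferentiableAt_id)
    have hs' : -s ∈ Metric.ball (0 : ℝ) ε := by
      have h1 := hsub hs
      rw [mem_ball_zero_iff] at h1 ⊢
      rwa [norm_neg]
    have h1 := mfderiv_comp x (hd (-s) hs' (ρ (s, x))) (hd s (hsub hs) x)
    have h2 : (fun x => ρ (-s, x)) ∘ (fun x => ρ (s, x)) = id := funext fun x => hinv s x
    rw [h2, mfderiv_id] at h1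
    intro v w hvw
    have h3 := congrArg (fun A : TangentSpace (𝓡 (2 * n + 1)) x →L[ℝ]
      TangentSpace (𝓡 (2 * n + 1)) x => A v) h1
    have h4 := congrArg (fun A : TangentSpace (𝓡 (2 * n + 1)) x →L[ℝ]
      TangentSpace (𝓡 (2 * n + 1)) x => A w) h1
    exact h3.trans ((congrArg _ hvw).trans h4.symm)
  · intro x
    have hev : (fun q : ℝ × M => ρ (q.1 * b q.1, q.2)) =ᶠ[𝓝 (s, x)] ρ := by
      filter_upwards [(Metric.isOpen_ball.preimage continuous_fst).mem_nhds
        (show (s, x) ∈ Prod.fst ⁻¹' Metric.ball (0 : ℝ) (ε / 3) from hs)] with q hq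
      rw [hb1 q.1 hq]
    exact (hρ s (hsub hs) x).2.congr hev

end LocalFlow

/-- A continuous function of negative mean on `[0,1]` is dominated there by the derivative of a
smooth function that vanishes at both ends. -/
theorem exists_contDiff_lt_deriv {h : ℝ → ℝ} (hc : Continuous h)
    (hI : ∫ t in (0 : ℝ)..1, h t < 0) :
    ∃ c : ℝ → ℝ, ContDiff ℝ ∞ c ∧ c 0 = 0 ∧ c 1 = 0 ∧ ∀ t ∈ Icc (0 : ℝ) 1, h t < deriv c t := by
  set I := ∫ t in (0 : ℝ)..1, h t with hIdef
  -- With error `-I / 3` the mean `J` of `p` is at most `2I / 3`, so `p - J > h + I / 3 - 2I / 3 = h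
  -- - I / 3 > h`. Subtracting `J` makes the primitive vanish at `1`.
  obtain ⟨p, hp⟩ := exists_polynomial_near_of_continuousOn 0 1 h hc.continuousOn (-I / 3)
    (by linarith)
  have hpc : Continuous fun t => p.eval t := p.continuous
  set J := ∫ t in (0 : ℝ)..1, p.eval t with hJ
  have hJI : J ≤ I + -I / 3 := by
    have h1 : J ≤ ∫ t in (0 : ℝ)..1, (h t + -I / 3) := by
      refine intervalIntegral.integral_mono_on zero_le_one (hpc.intervalIntegrable _ _)
        ((hc.add continuous_const).intervalIntegrable _ _) fun t ht => ?_
      have := (abs_lt.1 (hp t ht)).2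
      linarith
    rw [intervalIntegral.integral_add (hc.intervalIntegrable _ _)
      (continuous_const.intervalIntegrable _ _)] at h1
    simpa using h1
  have hd : ∀ t, HasDerivAt (fun t => ∫ s in (0 : ℝ)..t, (p.eval s - J)) (p.eval t - J) t :=
    fun t => ((hpc.sub continuous_const).integral_hasStrictDerivAt 0 t).hasDerivAt
  have hd' : deriv (fun t => ∫ s in (0 : ℝ)..t, (p.eval s - J)) = fun t => p.eval t - J :=
    funext fun t => (hd t).deriv
  refine ⟨fun t => ∫ s in (0 : ℝ)..t, (p.eval s - J), ?_, by simp, ?_, fun t ht => ?_⟩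
  · rw [contDiff_infty_iff_deriv, hd']
    exact ⟨fun t => (hd t).differentiableAt, (p.contDiff_aeval ∞).sub contDiff_const⟩
  · simp only
    rw [intervalIntegral.integral_sub (hpc.intervalIntegrable _ _)
      (continuous_const.intervalIntegrable _ _)]
    simp [hJ]
  · rw [hd']
    have := (abs_lt.1 (hp t ht)).1
    simp only
    linarith

/-! ### The function `α(velocity)`: continuity and chain rule. -/

section FormVelocity

variable {n : ℕ} {M : Type*} [TopologicalSpace M]
  [ChartedSpace (EuclideanSpace ℝ (Fin (2 * n + 1))) M] [IsManifold (𝓡 (2 * n + 1)) ∞ M]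
  {k : ℕ} {N : Type*} [TopologicalSpace N] [ChartedSpace (EuclideanSpace ℝ (Fin k)) N]

/-- Joint continuity in time and point is what makes the integrand of `hoferLength` continuous and
gives positive isotopies a uniform lower bound. -/
theorem continuous_form_velocity [IsManifold (𝓡 k) ∞ N] (α : ContactForm n M) {F : ℝ × N → M}
    (hF : ContMDiff (𝓘(ℝ, ℝ).prod (𝓡 k)) (𝓡 (2 * n + 1)) ∞ F) :
    Continuous fun q : ℝ × N => α.form (F q) (velocity n (fun s => F (s, q.2)) q.1) := by
  have : IsManifold (𝓡 (2 * n + 1)) 1 M := IsManifold.of_le (n := ∞) (by simp)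
  have : IsManifold (𝓡 k) 1 N := IsManifold.of_le (n := ∞) (by simp)
  rw [continuous_iff_continuousAt]
  intro q₀
  have h1 : ContMDiffAt (𝓘(ℝ, ℝ).prod (𝓡 k)) 𝓘(ℝ, ℝ →L[ℝ] EuclideanSpace ℝ (Fin (2 * n + 1))) 0
      (inTangentCoordinates 𝓘(ℝ, ℝ) (𝓡 (2 * n + 1)) (fun q : ℝ × N => q.1) (fun q => F (q.1, q.2))
        (fun q => mfderiv 𝓘(ℝ, ℝ) (𝓡 (2 * n + 1)) (fun s => F (s, q.2)) q.1) q₀) q₀ := by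
    refine ContMDiffAt.mfderiv (n := ∞) (fun (q : ℝ × N) (s : ℝ) => F (s, q.2))
      (fun q : ℝ × N => q.1) ?_ contMDiffAt_fst (by norm_num)
    exact (hF _).comp (q₀, q₀.1) (contMDiffAt_snd.prodMk (contMDiffAt_snd.comp _ contMDiffAt_fst))
  have hsrc : ∀ᶠ q in 𝓝 q₀, F q ∈ (extChartAt (𝓡 (2 * n + 1)) (F q₀)).source :=
    hF.continuous.continuousAt.preimage_mem_nhds (extChartAt_source_mem_nhds _)
  have h2 : ContinuousAt (fun q : ℝ × N =>
      (chartDeriv (F q₀) (F q) (velocity n (fun s => F (s, q.2)) q.1))) q₀ := by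
    refine (h1.continuousAt.clm_apply (continuousAt_const (y := (1 : ℝ)))).congr ?_
    filter_upwards [hsrc] with q hq
    have hq₁ : q.1 ∈ (chartAt ℝ q₀.1).source := mem_univ q.1
    have hq₂ : F q ∈ (chartAt (EuclideanSpace ℝ (Fin (2 * n + 1))) (F q₀)).source := by
      simpa using hq
    rw [inTangentCoordinates_eq_mfderiv_comp hq₁ hq₂]
    have h3 : mfderivWithin 𝓘(ℝ, ℝ) 𝓘(ℝ, ℝ) (extChartAt 𝓘(ℝ, ℝ) q₀.1).symm (range 𝓘(ℝ, ℝ))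
        (extChartAt 𝓘(ℝ, ℝ) q₀.1 q.1) (1 : ℝ) = (1 : ℝ) := by
      rw [mfderivWithin_eq_fderivWithin, ModelWithCorners.range_eq_univ, fderivWithin_univ]
      exact congrArg (fun A : ℝ →L[ℝ] ℝ => A 1) (fderiv_id (𝕜 := ℝ) (x := q.1))
    exact congrArg (fun r : ℝ => chartDeriv (F q₀) (F q)
      (mfderiv 𝓘(ℝ, ℝ) (𝓡 (2 * n + 1)) (fun s => F (s, q.2)) q.1 r)) h3
  have h4 : ContinuousAt (fun q => localForm α.form (F q₀) (extChartAt (𝓡 (2 * n + 1)) (F q₀) (F q)))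
      q₀ :=
    ((contDiffAt_localForm α (mem_extChartAt_target (F q₀))).continuousAt).comp
      (f := fun q => extChartAt (𝓡 (2 * n + 1)) (F q₀) (F q))
      ((continuousAt_extChartAt (F q₀)).comp hF.continuous.continuousAt)
  refine (h4.clm_apply h2).congr ?_
  filter_upwards [hsrc] with q hq using (form_eq_localForm α hq _).symm

theorem continuous_iSup_abs_form_velocity [IsManifold (𝓡 k) ∞ N] [CompactSpace N]
    (α : ContactForm n M) {F : ℝ → N → M}
    (hF : ContMDiff (𝓘(ℝ, ℝ).prod (𝓡 k)) (𝓡 (2 * n + 1)) ∞ fun q : ℝ × N => F q.1 q.2) :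
    Continuous fun t => ⨆ x, |α.form (F t x) (velocity n (fun s => F s x) t)| := by
  have h1 : Continuous fun q : ℝ × N => |α.form (F q.1 q.2) (velocity n (fun s => F s q.2) q.1)| :=
    (continuous_form_velocity α hF).abs
  have h2 := isCompact_univ.continuous_sSup
    (f := fun (t : ℝ) (x : N) => |α.form (F t x) (velocity n (fun s => F s x) t)|) h1
  simp only [image_univ] at h2
  exact h2

theorem abs_form_velocity_le_iSup [IsManifold (𝓡 k) ∞ N] [CompactSpace N]
    (α : ContactForm n M) {F : ℝ → N → M}
    (hF : ContMDiff (𝓘(ℝ, ℝ).prod (𝓡 k)) (𝓡 (2 * n + 1)) ∞ fun q : ℝ × N => F q.1 q.2)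
    (t : ℝ) (x : N) :
    |α.form (F t x) (velocity n (fun s => F s x) t)| ≤
      ⨆ x, |α.form (F t x) (velocity n (fun s => F s x) t)| := by
  have h1 : Continuous fun x : N => |α.form (F t x) (velocity n (fun s => F s x) t)| :=
    (continuous_form_velocity α hF).abs.comp (Continuous.prodMk_right t)
  exact le_ciSup (f := fun x => |α.form (F t x) (velocity n (fun s => F s x) t)|)
    (isCompact_range h1).bddAbove x

theorem velocity_comp_prod {F : ℝ × N → M} {u : ℝ → ℝ} {z : ℝ → N} {t u' : ℝ}
    (hF : MDifferentiableAt (𝓘(ℝ, ℝ).prod (𝓡 k)) (𝓡 (2 * n + 1)) F (u t, z t))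
    (hu : HasDerivAt u u' t) (hz : MDifferentiableAt 𝓘(ℝ, ℝ) (𝓡 k) z t) :
    velocity n (fun s => F (u s, z s)) t =
      mfderiv (𝓘(ℝ, ℝ).prod (𝓡 k)) (𝓡 (2 * n + 1)) F (u t, z t)
        (u', mfderiv 𝓘(ℝ, ℝ) (𝓡 k) z t (1 : ℝ)) := by
  have h1 := hF.hasMFDerivAt.comp t (hu.hasFDerivAt.hasMFDerivAt.prodMk hz.hasMFDerivAt)
  have h2 := congrArg (fun A : ℝ →L[ℝ] EuclideanSpace ℝ (Fin (2 * n + 1)) => A 1) h1.mfderiv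
  refine Eq.trans h2 ?_
  refine congrArg (fun r : ℝ => mfderiv (𝓘(ℝ, ℝ).prod (𝓡 k)) (𝓡 (2 * n + 1)) F (u t, z t)
    ((r, mfderiv 𝓘(ℝ, ℝ) (𝓡 k) z t (1 : ℝ)) : ℝ × EuclideanSpace ℝ (Fin k))) ?_
  exact one_smul ℝ u'

theorem form_velocity_comp_prod (α : ContactForm n M) {F : ℝ × N → M} {u : ℝ → ℝ} {z : ℝ → N}
    {t u' : ℝ}
    (hF : MDifferentiableAt (𝓘(ℝ, ℝ).prod (𝓡 k)) (𝓡 (2 * n + 1)) F (u t, z t))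
    (hu : HasDerivAt u u' t) (hz : MDifferentiableAt 𝓘(ℝ, ℝ) (𝓡 k) z t) :
    α.form (F (u t, z t)) (velocity n (fun s => F (u s, z s)) t) =
      u' * α.form (F (u t, z t)) (velocity n (fun s => F (s, z t)) (u t)) +
      α.form (F (u t, z t)) (mfderiv (𝓡 k) (𝓡 (2 * n + 1)) (fun y => F (u t, y)) (z t)
        (mfderiv 𝓘(ℝ, ℝ) (𝓡 k) z t (1 : ℝ))) := by
  refine (congrArg (α.form (F (u t, z t)))
    ((velocity_comp_prod hF hu hz).trans (mfderiv_prod_eq_add_apply hF))).trans ?_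
  refine (map_add (α.form (F (u t, z t))) _ _).trans ?_
  congr 1
  have h1 : mfderiv 𝓘(ℝ, ℝ) (𝓡 (2 * n + 1)) (fun s => F (s, z t)) (u t) u' =
      u' • velocity n (fun s => F (s, z t)) (u t) := by
    have h2 := map_smul (mfderiv 𝓘(ℝ, ℝ) (𝓡 (2 * n + 1)) (fun s => F (s, z t)) (u t)) u' (1 : ℝ)
    refine Eq.trans ?_ h2
    exact congrArg (fun r : ℝ => mfderiv 𝓘(ℝ, ℝ) (𝓡 (2 * n + 1)) (fun s => F (s, z t)) (u t) r)
      (mul_one u').symm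
  refine (congrArg (α.form (F (u t, z t))) h1).trans ?_
  exact map_smul (α.form (F (u t, z t))) u' _

end FormVelocity

/-! ### Correcting an isotopy by the Reeb flow. -/

section Isotopies

variable {n : ℕ} {M : Type*} [TopologicalSpace M]
  [ChartedSpace (EuclideanSpace ℝ (Fin (2 * n + 1))) M] [IsManifold (𝓡 (2 * n + 1)) ∞ M]
  {Λ : Type*} [TopologicalSpace Λ] [ChartedSpace (EuclideanSpace ℝ (Fin n)) Λ]

/-- A map that is an injective immersion and preserves the kernel of the contact form takes
Legendrian embeddings to Legendrian embeddings. -/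
theorem IsLegendrianEmbedding.comp {α : ContactForm n M} {f : Λ → M}
    (hf : IsLegendrianEmbedding α f) {φ : M → M}
    (hφ : ContMDiff (𝓡 (2 * n + 1)) (𝓡 (2 * n + 1)) ∞ φ) (hinj : Function.Injective φ)
    (himm : ∀ x, Function.Injective (mfderiv (𝓡 (2 * n + 1)) (𝓡 (2 * n + 1)) φ x))
    (hker : ∀ (x : M) (v : TangentSpace (𝓡 (2 * n + 1)) x), α.form x v = 0 →
      α.form (φ x) (mfderiv (𝓡 (2 * n + 1)) (𝓡 (2 * n + 1)) φ x v) = 0) :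
    IsLegendrianEmbedding α (fun p => φ (f p)) := by
  obtain ⟨h1, h2, h3, h4⟩ := hf
  have hd : ∀ p, mfderiv (𝓡 n) (𝓡 (2 * n + 1)) (fun p => φ (f p)) p =
      (mfderiv (𝓡 (2 * n + 1)) (𝓡 (2 * n + 1)) φ (f p)).comp
        (mfderiv (𝓡 n) (𝓡 (2 * n + 1)) f p) := fun p =>
    mfderiv_comp p (hφ.mdifferentiable (by simp) _) (h1.mdifferentiable (by simp) _)
  refine ⟨hφ.comp h1, hinj.comp h2, fun p => ?_, fun p v => ?_⟩
  · rw [hd]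
    exact (himm (f p)).comp (h3 p)
  · rw [hd]
    exact hker _ _ (h4 p v)

theorem injective_mfderiv_diffeomorph (φ : M ≃ₘ^∞⟮𝓡 (2 * n + 1), 𝓡 (2 * n + 1)⟯ M) (x : M) :
    Function.Injective (mfderiv (𝓡 (2 * n + 1)) (𝓡 (2 * n + 1)) φ x) :=
  (φ.mfderivToContinuousLinearEquiv (by simp) x).injective

theorem form_mfderiv_of_eq_id (α : ContactForm n M) {g : M → M} (hg : g = id) (x : M)
    (v : TangentSpace (𝓡 (2 * n + 1)) x) :
    α.form (g x) (mfderiv (𝓡 (2 * n + 1)) (𝓡 (2 * n + 1)) g x v) = α.form x v := by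
  subst hg
  rw [mfderiv_id]
  rfl

/-- If the velocity of a Legendrian isotopy `l` from `L₀` to `L₁` pairs with `α` to at least `δ`,
then a contact isotopy shorter than `δ`, run while `l` is at rest, keeps it positive
after a correction by the Reeb flow `ρ`. -/
theorem exists_positive_isotopy [CompactSpace M] {α : ContactForm n M} {ε δ : ℝ} {ρ : ℝ × M → M}
    (hρ : ContMDiff (𝓘(ℝ, ℝ).prod (𝓡 (2 * n + 1))) (𝓡 (2 * n + 1)) ∞ ρ) (hρ0 : ∀ x, ρ (0, x) = x)
    (hρε : ∀ s ∈ Metric.ball (0 : ℝ) ε,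
        (Function.Injective fun x => ρ (s, x)) ∧
        (∀ x, Function.Injective
          (mfderiv (𝓡 (2 * n + 1)) (𝓡 (2 * n + 1)) (fun x => ρ (s, x)) x)) ∧
        ∀ x, IsReebDeriv α ρ (s, x))
    {l : ℝ → Λ → M} {L₀ L₁ : Set M} (hl : IsLegendrianIsotopy α l L₀ L₁) (hδε : δ < ε)
    (hδ0 : 0 < δ)
    (hlδ : ∀ t ∈ Icc (0 : ℝ) 1, ∀ p, δ ≤ α.form (l t p) (velocity n (fun s => l s p) t))
    {Φ : ℝ → M → M} (hΦ : IsContactIsotopy α Φ) (hΦ0 : Φ 0 = id)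
    {a b : ℝ → ℝ} (ha : ContDiff ℝ ∞ a) (hb : ContDiff ℝ ∞ b)
    (haI : ∀ t ∈ Icc (0 : ℝ) 1, a t ∈ Icc (0 : ℝ) 1)
    (hbI : ∀ t ∈ Icc (0 : ℝ) 1, b t ∈ Icc (0 : ℝ) 1) (ha0 : a 0 = 0) (ha1 : a 1 = 1)
    (ha' : ∀ t ∈ Icc (0 : ℝ) 1, 0 ≤ deriv a t)
    (hab : ∀ t ∈ Icc (0 : ℝ) 1, deriv a t = 0 ∨ b t = 0)
    (hint : ∫ t in (0 : ℝ)..1, |deriv b t| *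
      (⨆ x, |α.form (Φ (b t) x) (velocity n (fun s => Φ s x) (b t))|) < δ) :
    ∃ m : ℝ → Λ → M, IsLegendrianIsotopy α m (Φ (b 0) '' L₀) (Φ (b 1) '' L₁) ∧
      ∀ t ∈ Icc (0 : ℝ) 1, ∀ p, 0 < α.form (m t p) (velocity n (fun s => m s p) t) := by
  set κ : ℝ → ℝ := fun t => ⨆ x, |α.form (Φ t x) (velocity n (fun s => Φ s x) t)| with hκ
  obtain ⟨hls, hle, hl0, hl1⟩ := hl
  obtain ⟨hΦs, hΦc⟩ := hΦ
  have hκc : Continuous κ := continuous_iSup_abs_form_velocity α hΦs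
  have hκ0 : ∀ t, 0 ≤ κ t := fun t => Real.iSup_nonneg fun x => abs_nonneg _
  have hca' : Continuous (deriv a) := ha.continuous_deriv (by simp)
  have hcb' : Continuous (deriv b) := hb.continuous_deriv (by simp)
  have hda : ∀ t, HasDerivAt a (deriv a t) t := fun t =>
    (ha.differentiable (by simp) t).hasDerivAt
  have hdb : ∀ t, HasDerivAt b (deriv b t) t := fun t =>
    (hb.differentiable (by simp) t).hasDerivAt
  have hc2 : Continuous fun t => |deriv b t| * κ (b t) :=
    hcb'.abs.mul (hκc.comp hb.continuous)
  have hc3 : Continuous fun t => δ * deriv a t := continuous_const.mul hca'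
  have hh : Continuous fun t => |deriv b t| * κ (b t) - δ * deriv a t :=
    hc2.sub hc3
  have hneg : ∫ t in (0 : ℝ)..1, (|deriv b t| * κ (b t) - δ * deriv a t) < 0 := by
    rw [intervalIntegral.integral_sub (hc2.intervalIntegrable _ _)
      (hc3.intervalIntegrable _ _), intervalIntegral.integral_const_mul,
      intervalIntegral.integral_deriv_eq_sub (fun t _ => ha.differentiable (by simp) t)
        (hca'.intervalIntegrable _ _), ha0, ha1]
    linarith
  obtain ⟨c, hc, hc0, hc1, hcd⟩ := exists_contDiff_lt_deriv hh hneg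
  have hdc : ∀ t, HasDerivAt c (deriv c t) t := fun t =>
    (hc.differentiable (by simp) t).hasDerivAt
  -- `c + δ * a` increases from `0` to `δ`, so `-δ ≤ c ≤ δ`, and `δ < ε` keeps the Reeb time in its
  -- good range.
  have hcε : ∀ t ∈ Icc (0 : ℝ) 1, c t ∈ Metric.ball (0 : ℝ) ε := by
    have hmono : MonotoneOn (fun t => c t + δ * a t) (Icc 0 1) := by
      refine monotoneOn_of_deriv_nonneg (convex_Icc _ _)
        (hc.continuous.add (continuous_const.mul ha.continuous)).continuousOn
        (fun t _ => ((hdc t).add ((hda t).const_mul δ)).differentiableAt.differentiableWithinAt)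
        fun t ht => ?_
      rw [((hdc t).fun_add ((hda t).const_mul δ)).deriv]
      have h1 := hcd t (interior_subset ht)
      have h2 := mul_nonneg (abs_nonneg (deriv b t)) (hκ0 (b t))
      linarith
    intro t ht
    have h0 : (0 : ℝ) ∈ Icc (0 : ℝ) 1 := ⟨le_rfl, zero_le_one⟩
    have h1 : (1 : ℝ) ∈ Icc (0 : ℝ) 1 := ⟨zero_le_one, le_rfl⟩
    have h2 := hmono h0 ht ht.1
    have h3 := hmono ht h1 ht.2
    simp only [hc0, hc1, ha0, ha1] at h2 h3
    have h4 := haI t ht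
    have h5 := mul_le_mul_of_nonneg_left h4.2 hδ0.le
    have h6 := mul_nonneg hδ0.le h4.1
    rw [mem_ball_zero_iff, Real.norm_eq_abs, abs_lt]
    constructor <;> linarith
  have hw : ∀ p, ContMDiff 𝓘(ℝ, ℝ) (𝓡 (2 * n + 1)) ∞ fun s => l (a s) p := fun p =>
    hls.comp (ha.contMDiff.prodMk contMDiff_const)
  have hy : ∀ p, ContMDiff 𝓘(ℝ, ℝ) (𝓡 (2 * n + 1)) ∞ fun s => Φ (b s) (l (a s) p) := fun p =>
    hΦs.comp (hb.contMDiff.prodMk (hw p))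
  refine ⟨fun t p => ρ (c t, Φ (b t) (l (a t) p)), ⟨?_, fun t ht => ?_, ?_, ?_⟩, fun t ht p => ?_⟩
  · have h1 : ContMDiff (𝓘(ℝ, ℝ).prod (𝓡 n)) (𝓡 (2 * n + 1)) ∞
        fun q : ℝ × Λ => l (a q.1) q.2 :=
      hls.comp ((ha.contMDiff.comp contMDiff_fst).prodMk contMDiff_snd)
    have h2 : ContMDiff (𝓘(ℝ, ℝ).prod (𝓡 n)) (𝓡 (2 * n + 1)) ∞
        fun q : ℝ × Λ => Φ (b q.1) (l (a q.1) q.2) :=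
      hΦs.comp ((hb.contMDiff.comp contMDiff_fst).prodMk h1)
    exact hρ.comp ((hc.contMDiff.comp contMDiff_fst).prodMk h2)
  · obtain ⟨φ, hφ, hφΦ⟩ := hΦc (b t) (hbI t ht)
    change IsLegendrianEmbedding α fun p => ρ (c t, Φ (b t) (l (a t) p))
    rw [← hφΦ]
    obtain ⟨h1, h2, h3⟩ := hρε (c t) (hcε t ht)
    refine ((hle (a t) (haI t ht)).comp φ.contMDiff φ.injective
      (injective_mfderiv_diffeomorph φ) fun x v hv => (hφ x v).2 hv).comp
      (φ := fun x => ρ (c t, x)) (hρ.comp (contMDiff_const.prodMk contMDiff_id)) h1 h2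
      fun x v hv => ?_
    -- With time component `0`, `IsReebDeriv` says that the time map of `ρ` preserves `α`, hence its
    -- kernel.
    have h4 := h3 x 0 v
    rw [hv, add_zero] at h4
    have h5 : mfderiv (𝓘(ℝ, ℝ).prod (𝓡 (2 * n + 1))) (𝓡 (2 * n + 1)) ρ (c t, x) (0, v) =
        mfderiv (𝓡 (2 * n + 1)) (𝓡 (2 * n + 1)) (fun x => ρ (c t, x)) x v :=
      (mfderiv_prod_eq_add_apply (hρ.mdifferentiable (by simp) _)).trans
        ((congrArg (· + _) (map_zero _)).trans (zero_add _))
    exact (congrArg (α.form (ρ (c t, x))) h5).symm.trans h4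
  · simp only [hc0, hρ0, ha0, ← hl0, ← range_comp]
    rfl
  · simp only [hc1, hρ0, ha1, ← hl1, ← range_comp]
    rfl
  · set x := l (a t) p with hx
    set y := Φ (b t) x with hydef
    -- By `ρ^*α = ds + α` the correction contributes exactly `deriv c t`. The remaining term splits
    -- into the motion of `Φ`, bounded below in `h4`, and that of `l`, bounded below in `h5`.
    have h1 : α.form (ρ (c t, y)) (velocity n (fun s => ρ (c s, Φ (b s) (l (a s) p))) t) =
        deriv c t + α.form y (velocity n (fun s => Φ (b s) (l (a s) p)) t) :=
      (congrArg (α.form (ρ (c t, y))) (velocity_comp_prod (F := ρ) (u := c)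
        (z := fun s => Φ (b s) (l (a s) p)) (hρ.mdifferentiable (by simp) _) (hdc t)
        ((hy p).mdifferentiable (by simp) t))).trans ((hρε (c t) (hcε t ht)).2.2 y _ _)
    have h2 := form_velocity_comp_prod α (F := fun q : ℝ × M => Φ q.1 q.2) (u := b)
      (z := fun s => l (a s) p) (hΦs.mdifferentiable (by simp) _) (hdb t)
      ((hw p).mdifferentiable (by simp) t)
    have h3 : mfderiv 𝓘(ℝ, ℝ) (𝓡 (2 * n + 1)) (fun s => l (a s) p) t (1 : ℝ) =
        deriv a t • velocity n (fun s => l s p) (a t) := by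
      have hlp : ContMDiff 𝓘(ℝ, ℝ) (𝓡 (2 * n + 1)) ∞ fun s => l s p :=
        hls.comp (contMDiff_id.prodMk contMDiff_const)
      have h6 := (hlp.mdifferentiable (by simp) (a t)).hasMFDerivAt.comp t
        (hda t).hasFDerivAt.hasMFDerivAt
      refine Eq.trans (congrArg (fun A : ℝ →L[ℝ] EuclideanSpace ℝ (Fin (2 * n + 1)) => A 1)
        h6.mfderiv) ?_
      refine Eq.trans ?_ (map_smul (mfderiv 𝓘(ℝ, ℝ) (𝓡 (2 * n + 1)) (fun s => l s p) (a t))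
        (deriv a t) (1 : ℝ))
      refine congrArg (fun r : ℝ =>
        mfderiv 𝓘(ℝ, ℝ) (𝓡 (2 * n + 1)) (fun s => l s p) (a t) r) ?_
      exact (one_smul ℝ (deriv a t)).trans (mul_one (deriv a t)).symm
    have h4 : -(|deriv b t| * κ (b t)) ≤
        deriv b t * α.form y (velocity n (fun s => Φ s x) (b t)) := by
      have h5 := abs_form_velocity_le_iSup α hΦs (b t) x
      have h6 := neg_abs_le (deriv b t * α.form y (velocity n (fun s => Φ s x) (b t)))
      rw [abs_mul] at h6
      have h7 := mul_le_mul_of_nonneg_left h5 (abs_nonneg (deriv b t))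
      exact (neg_le_neg h7).trans h6
    -- A contactomorphism may rescale `α`, which would spoil the bound `δ`. By `hab`, however, `Φ (b
    -- t)` is the identity whenever `deriv a t` is nonzero.
    have h5 : δ * deriv a t ≤ α.form y (mfderiv (𝓡 (2 * n + 1)) (𝓡 (2 * n + 1))
        (fun z => Φ (b t) z) x
        (mfderiv 𝓘(ℝ, ℝ) (𝓡 (2 * n + 1)) (fun s => l (a s) p) t (1 : ℝ))) := by
      rcases hab t ht with h | h
      · have h6 : mfderiv 𝓘(ℝ, ℝ) (𝓡 (2 * n + 1)) (fun s => l (a s) p) t (1 : ℝ) = 0 := by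
          rw [h3, h]
          exact zero_smul ℝ _
        rw [h, mul_zero, h6]
        exact le_of_eq ((congrArg (α.form y) (map_zero _)).trans (map_zero (α.form y))).symm
      · have h6 := form_mfderiv_of_eq_id α (show Φ (b t) = id by rw [h, hΦ0]) x
          (mfderiv 𝓘(ℝ, ℝ) (𝓡 (2 * n + 1)) (fun s => l (a s) p) t (1 : ℝ))
        refine le_of_le_of_eq ?_ h6.symm
        refine le_of_le_of_eq ?_ ((congrArg (α.form x) h3).trans
          (map_smul (α.form x) (deriv a t) _)).symm
        rw [mul_comm, smul_eq_mul]
        exact mul_le_mul_of_nonneg_left (hlδ (a t) (haI t ht) p) (ha' t ht)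
    have h6 := hcd t ht
    have h7 : α.form y (velocity n (fun s => Φ (b s) (l (a s) p)) t) = _ := h2
    refine lt_of_lt_of_eq ?_ h1.symm
    rw [h7]
    have h8 : -(|deriv b t| * κ (b t)) + δ * deriv a t ≤ _ := add_le_add h4 h5
    linarith

end Isotopies

/-! ### Time changes that run two isotopies one after the other. -/

section Reparametrisation

/-- A smooth monotone step from `0` to `1` during `[0, 1/2]`. -/
def earlyStep (t : ℝ) : ℝ := Real.smoothTransition (2 * t)

/-- A smooth monotone step from `0` to `1` during `[1/2, 1]`. -/
def lateStep (t : ℝ) : ℝ := Real.smoothTransition (2 * t - 1)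

theorem contDiff_earlyStep : ContDiff ℝ ∞ earlyStep :=
  Real.smoothTransition.contDiff.comp (contDiff_const.mul contDiff_id)

theorem contDiff_lateStep : ContDiff ℝ ∞ lateStep :=
  Real.smoothTransition.contDiff.comp ((contDiff_const.mul contDiff_id).sub contDiff_const)

theorem earlyStep_mem_Icc (t : ℝ) : earlyStep t ∈ Icc (0 : ℝ) 1 :=
  ⟨Real.smoothTransition.nonneg _, Real.smoothTransition.le_one _⟩

theorem lateStep_mem_Icc (t : ℝ) : lateStep t ∈ Icc (0 : ℝ) 1 :=
  ⟨Real.smoothTransition.nonneg _, Real.smoothTransition.le_one _⟩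

theorem earlyStep_zero : earlyStep 0 = 0 := Real.smoothTransition.zero_of_nonpos (by norm_num)

theorem earlyStep_one : earlyStep 1 = 1 := Real.smoothTransition.one_of_one_le (by norm_num)

theorem lateStep_zero : lateStep 0 = 0 := Real.smoothTransition.zero_of_nonpos (by norm_num)

theorem lateStep_one : lateStep 1 = 1 := Real.smoothTransition.one_of_one_le (by norm_num)

theorem deriv_earlyStep_nonneg (t : ℝ) : 0 ≤ deriv earlyStep t :=
  Monotone.deriv_nonneg fun x y h => Real.smoothTransition.monotone (by linarith)

theorem deriv_lateStep_nonneg (t : ℝ) : 0 ≤ deriv lateStep t :=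
  Monotone.deriv_nonneg fun x y h => Real.smoothTransition.monotone (by linarith)

theorem earlyStep_eq_one_and_or (t : ℝ) :
    (earlyStep t = 1 ∧ deriv earlyStep t = 0) ∨ (lateStep t = 0 ∧ deriv lateStep t = 0) := by
  rcases le_total (1 / 2) t with h | h
  · have h1 : earlyStep t = 1 := Real.smoothTransition.one_of_one_le (by linarith)
    -- The value `1` is a global maximum, so the derivative vanishes even at the junction `t = 1 /
    -- 2`.
    refine Or.inl ⟨h1, IsLocalMax.deriv_eq_zero (Filter.Eventually.of_forall fun s => ?_)⟩
    rw [h1]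
    exact (earlyStep_mem_Icc s).2
  · have h1 : lateStep t = 0 := Real.smoothTransition.zero_of_nonpos (by linarith)
    refine Or.inr ⟨h1, IsLocalMin.deriv_eq_zero (Filter.Eventually.of_forall fun s => ?_)⟩
    rw [h1]
    exact (lateStep_mem_Icc s).1

/-- Monotone reparametrisation does not change the length of the contact isotopy; the next lemma
does the same for the reversed isotopy. -/
theorem integral_abs_deriv_lateStep_mul {κ : ℝ → ℝ} (hκ : Continuous κ) :
    ∫ t in (0 : ℝ)..1, |deriv lateStep t| * κ (lateStep t) = ∫ t in (0 : ℝ)..1, κ t := by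
  have h := intervalIntegral.integral_comp_mul_deriv (a := 0) (b := 1) (f := lateStep)
    (f' := deriv lateStep) (g := κ)
    (fun t _ => (contDiff_lateStep.differentiable (by simp) t).hasDerivAt)
    (contDiff_lateStep.continuous_deriv (by simp)).continuousOn hκ
  rw [lateStep_zero, lateStep_one] at h
  rw [← h]
  exact intervalIntegral.integral_congr fun t _ => by
    simp only [Function.comp_apply, abs_of_nonneg (deriv_lateStep_nonneg t)]
    ring

theorem integral_abs_deriv_one_sub_earlyStep_mul {κ : ℝ → ℝ} (hκ : Continuous κ) :
    ∫ t in (0 : ℝ)..1, |deriv (fun t => 1 - earlyStep t) t| * κ (1 - earlyStep t) =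
      ∫ t in (0 : ℝ)..1, κ t := by
  have h := intervalIntegral.integral_comp_mul_deriv (a := 0) (b := 1) (f := earlyStep)
    (f' := deriv earlyStep) (g := fun u => κ (1 - u))
    (fun t _ => (contDiff_earlyStep.differentiable (by simp) t).hasDerivAt)
    (contDiff_earlyStep.continuous_deriv (by simp)).continuousOn
    (hκ.comp (continuous_const.sub continuous_id))
  rw [earlyStep_zero, earlyStep_one, intervalIntegral.integral_comp_sub_left, sub_self,
    sub_zero] at h
  rw [← h]
  exact intervalIntegral.integral_congr fun t _ => by
    simp only [Function.comp_apply, deriv_const_sub, abs_neg,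
      abs_of_nonneg (deriv_earlyStep_nonneg t)]
    ring

end Reparametrisation

/-! ### Openness of futures and pasts. -/

section Openness

variable {n : ℕ} {M : Type*} [TopologicalSpace M]
  [ChartedSpace (EuclideanSpace ℝ (Fin (2 * n + 1))) M] [IsManifold (𝓡 (2 * n + 1)) ∞ M]
  {Λ : Type*} [TopologicalSpace Λ] [ChartedSpace (EuclideanSpace ℝ (Fin n)) Λ]

theorem exists_pos_le_form_velocity [CompactSpace Λ] [IsManifold (𝓡 n) ∞ Λ] (α : ContactForm n M)
    {l : ℝ → Λ → M}
    (hl : ContMDiff (𝓘(ℝ, ℝ).prod (𝓡 n)) (𝓡 (2 * n + 1)) ∞ fun q : ℝ × Λ => l q.1 q.2)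
    (hpos : ∀ t ∈ Icc (0 : ℝ) 1, ∀ p, 0 < α.form (l t p) (velocity n (fun s => l s p) t)) :
    ∃ δ > 0, ∀ t ∈ Icc (0 : ℝ) 1, ∀ p,
      δ ≤ α.form (l t p) (velocity n (fun s => l s p) t) := by
  have hc := continuous_form_velocity α hl
  obtain ⟨δ, hδ, h⟩ := (isCompact_Icc.prod isCompact_univ).exists_forall_le'
    (s := Icc (0 : ℝ) 1 ×ˢ (univ : Set Λ)) hc.continuousOn (a := 0)
    fun q hq => hpos q.1 hq.1 q.2
  exact ⟨δ, hδ, fun t ht p => h (t, p) ⟨ht, mem_univ p⟩⟩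

theorem exists_contactIsotopy_of_rosenZhangDist_lt {α : ContactForm n M} {L K : Set M} {δ : ℝ}
    (h : rosenZhangDist α L K < ENNReal.ofReal δ) :
    ∃ Φ : ℝ → M → M, IsContactIsotopy α Φ ∧ Φ 0 = id ∧ Φ 1 '' L = K ∧ hoferLength α Φ < δ := by
  simp only [rosenZhangDist, hoferNorm, iInf_lt_iff] at h
  obtain ⟨φ, -, hLK, Φ, ⟨hΦ, h0, h1⟩, hlt⟩ := h
  exact ⟨Φ, hΦ, h0, by rw [h1, hLK], (ENNReal.ofReal_lt_ofReal_iff_of_nonneg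
    (intervalIntegral.integral_nonneg zero_le_one
      fun t _ => Real.iSup_nonneg fun x => abs_nonneg _)).1 hlt⟩

variable [T2Space M] [CompactSpace M] [CompactSpace Λ] [IsManifold (𝓡 n) ∞ Λ]
  {α : ContactForm n M} {ι : Λ → M}

theorem isOpen_chronFuture (L₀ : LegendrianClass α ι) :
    IsOpen[rosenZhangTopology α ι] (chronFuture L₀) := by
  rintro L ⟨l, hl, hpos⟩
  obtain ⟨ε, hε, ρ, hρ, hρ0, hρε⟩ := exists_smooth_reeb_family α
  obtain ⟨δ, hδ, hlδ⟩ := exists_pos_le_form_velocity α hl.1 hpos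
  -- The radius must be at most the surplus `δ` and also less than the time `ε` for which the Reeb
  -- flow is controlled.
  have hδ' : 0 < min δ (ε / 2) := lt_min hδ (by positivity)
  refine ⟨ENNReal.ofReal (min δ (ε / 2)), ENNReal.ofReal_pos.2 hδ', fun K hK => ?_⟩
  obtain ⟨Φ, hΦ, hΦ0, hΦ1, hlen⟩ := exists_contactIsotopy_of_rosenZhangDist_lt hK
  have hint := integral_abs_deriv_lateStep_mul (continuous_iSup_abs_form_velocity α hΦ.1)
  obtain ⟨m, hm, hm'⟩ := exists_positive_isotopy hρ hρ0 hρε hl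
    ((min_le_right _ _).trans_lt (half_lt_self hε)) hδ'
    (fun t ht p => (min_le_left _ _).trans (hlδ t ht p)) hΦ hΦ0
    contDiff_earlyStep contDiff_lateStep (fun t _ => earlyStep_mem_Icc t)
    (fun t _ => lateStep_mem_Icc t) earlyStep_zero earlyStep_one
    (fun t _ => deriv_earlyStep_nonneg t)
    (fun t _ => (earlyStep_eq_one_and_or t).imp And.right And.left) (hint.trans_lt hlen)
  rw [lateStep_zero, lateStep_one, hΦ0, hΦ1, image_id] at hm
  exact ⟨m, hm, hm'⟩

theorem isOpen_chronPast (L₁ : LegendrianClass α ι) :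
    IsOpen[rosenZhangTopology α ι] (chronPast L₁) := by
  rintro L ⟨l, hl, hpos⟩
  obtain ⟨ε, hε, ρ, hρ, hρ0, hρε⟩ := exists_smooth_reeb_family α
  obtain ⟨δ, hδ, hlδ⟩ := exists_pos_le_form_velocity α hl.1 hpos
  have hδ' : 0 < min δ (ε / 2) := lt_min hδ (by positivity)
  refine ⟨ENNReal.ofReal (min δ (ε / 2)), ENNReal.ofReal_pos.2 hδ', fun K hK => ?_⟩
  obtain ⟨Φ, hΦ, hΦ0, hΦ1, hlen⟩ := exists_contactIsotopy_of_rosenZhangDist_lt hK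
  have hint := integral_abs_deriv_one_sub_earlyStep_mul (continuous_iSup_abs_form_velocity α hΦ.1)
  obtain ⟨m, hm, hm'⟩ := exists_positive_isotopy hρ hρ0 hρε hl
    ((min_le_right _ _).trans_lt (half_lt_self hε)) hδ'
    (fun t ht p => (min_le_left _ _).trans (hlδ t ht p)) hΦ hΦ0
    -- `Φ` runs backwards during the first half, from `K = Φ 1 '' L` to `L`, and `l` follows in the
    -- second half.
    contDiff_lateStep (contDiff_const.sub contDiff_earlyStep) (fun t _ => lateStep_mem_Icc t)
    (fun t _ => ⟨sub_nonneg.2 (earlyStep_mem_Icc t).2, sub_le_self 1 (earlyStep_mem_Icc t).1⟩)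
    lateStep_zero lateStep_one (fun t _ => deriv_lateStep_nonneg t)
    (fun t _ => (earlyStep_eq_one_and_or t).symm.imp And.right fun h => by rw [h.1, sub_self])
    (hint.trans_lt hlen)
  rw [earlyStep_zero, earlyStep_one, sub_zero, sub_self, hΦ0, hΦ1, image_id] at hm
  exact ⟨m, hm, hm'⟩

theorem isOpen_rosenZhang_of_isOpen_interval {U : Set (LegendrianClass α ι)}
    (hU : IsOpen[intervalTopology α ι] U) : IsOpen[rosenZhangTopology α ι] U := by
  have h : rosenZhangTopology α ι ≤ intervalTopology α ι := by
    refine le_generateFrom ?_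
    rintro V ⟨L₀, L₁, rfl⟩
    exact @IsOpen.inter _ (rosenZhangTopology α ι) _ _ (isOpen_chronFuture L₀)
      (isOpen_chronPast L₁)
  exact h U hU

end Openness

end Contact

end

theorem mainTheorem12 {n : ℕ} {M : Type*} [TopologicalSpace M] [T2Space M] [CompactSpace M]
    [ChartedSpace (EuclideanSpace ℝ (Fin (2 * n + 1))) M] [IsManifold (𝓡 (2 * n + 1)) ∞ M]
    {Λ : Type*} [TopologicalSpace Λ] [CompactSpace Λ]
    [ChartedSpace (EuclideanSpace ℝ (Fin n)) Λ] [IsManifold (𝓡 n) ∞ Λ]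
    (α : Contact.ContactForm n M) (ι : Λ → M) (hι : Contact.IsLegendrianEmbedding α ι)
    (hord : Contact.IsOrderable α ι) :
    (∀ U : Set (Contact.LegendrianClass α ι),
      IsOpen[Contact.intervalTopology α ι] U → IsOpen[Contact.rosenZhangTopology α ι] U) ∧
    ∀ L : Contact.LegendrianClass α ι,
      IsOpen[Contact.rosenZhangTopology α ι] (Contact.chronFuture L) ∧
      IsOpen[Contact.rosenZhangTopology α ι] (Contact.chronPast L) := by
  exact ⟨fun _ hU => Contact.isOpen_rosenZhang_of_isOpen_interval hU,
    fun L => ⟨Contact.isOpen_chronFuture L, Contact.isOpen_chronPast L⟩⟩
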